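/- **Definitions.** Let $G=(V,E)$ be a finite simple graph with clique number $\omega(G)$. A *context* is a clique of size $\omega(G)$. A *$\{0,1\}$-coloring* is a map $f:V\to\{0,1\}$ with $\sum_{v\in C}f(v)\le 1$ for every clique $C$ and exactly one vertex of value $1$ in every context. A *$[0,1]$-assignment* is a map $f:V\to[0,1]$ with $\sum_{v\in c}f(v)=1$ for every context $c$. A *faithful orthogonal representation* of $G$ in $\mathbb C^d$ is a family of unit vectors $(\varphi_v)_{v\in V}$ in $\mathbb C^d$ such that $\langle\varphi_u,\varphi_v\rangle=0$ if and only if $u\sim v$, and $\varphi_u,\varphi_v$ are not parallel for $u\ne v$; $d^*(G)$ is the least dimension of such a representation. An *extended $01$-gadget in dimension $d$* is a $\{0,1\}$-colorable finite graph $G$ with $d^*(G)=\omega(G)=d$ and two distinct non-adjacent vertices $v_1,v_2$ such that $f(v_1)+f(v_2)<2$ for every $[0,1]$-assignment $f$. A *box* is a family of probability distributions $P(\cdot\,|\,c)$ on $c$, one for each context $c$. It is *consistent* if $P(s|c)=P(s|c')$ whenever $s\in c\cap c'$. A consistent box is *binary* if every context $c$ contains two distinct vertices $s_1,s_2$ with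 $P(s_1|c)+P(s_2|c)=1$. Let $\mathtt B^{\text{bin-cons}}_G$ be the convex hull of the binary boxes, and let the set $\mathtt B^{\text{bin}}_G$ of *fundamentally binary* boxes be the convex hull of those consistent boxes that arise from a binary box by relabelling the outcomes inside each context $c$ by a map $g_c:c\to c$. For a faithful orthogonal representation $\varphi$ in $\mathbb C^d$, $d=\omega(G)$, and a unit vector $\psi\in\mathbb C^d$, the *quantum box* is $P(a|c)=|\langle\varphi_a,\psi\rangle|^2$. **Theorem.** 1. Let $G$ be an extended $01$-gadget in dimension $d$ with distinguished vertices $v_1,v_2$. Then $\mathtt B^{\text{bin-cons}}_G\neq\emptyset$, and for all contexts $c_1\ni v_1$ and $c_2\ni v_2$: - every box $P$ in $\mathtt B^{\text{bin-cons}}_G$, and every box $P$ in $\mathtt B^{\text{bin}}_G$, satisfies $$P(v_1|c_1)+P(v_2|c_2)\le \tfrac32 ;$$ - the algebraic maximum of $P(v_1|c_1)+P(v_2|c_2)$, that is, its maximum over all boxes, is $2$; - for every faithful orthogonal representation $\varphi$ in $\mathbb C^d$ with $\langle\varphi_{v_1},\varphi_{v_2}\rangle=\cos\theta$, $0<\theta<\pi/2$,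 the vector $\psi=\frac{1}{\sqrt{2(1+\cos\theta)}}(\varphi_{v_1}+\varphi_{v_2})$ is a unit vector, its quantum box is consistent, and it has $P(v_1|c_1)+P(v_2|c_2)=1+\cos\theta$. 2. For every $d\ge 3$ and every $\theta\in(0,\pi/2)$ there is an extended $01$-gadget in dimension $d$, each of whose distinguished vertices $v_1,v_2$ lies in a context, with a faithful orthogonal representation in $\mathbb C^d$ such that $\langle\varphi_{v_1},\varphi_{v_2}\rangle=\cos\theta$. 3. Consequently, for every $d\ge3$ and every $\varepsilon>0$ there are an extended $01$-gadget in dimension $d$ and contexts $c_1\ni v_1$, $c_2\ni v_2$ for which $\mathtt B^{\text{bin-cons}}_G\ne\emptyset$, all fundamentally binary boxes satisfy $P(v_1|c_1)+P(v_2|c_2)\le\frac32$, the algebraic maximum is $2$, and some quantum box has $P(v_1|c_1)+P(v_2|c_2)>2-\varepsilon$. -/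

import Mathlib

namespace Contextuality

open scoped BigOperators

universe u

variable {V : Type u} [Fintype V]

/-- A context of an orthogonality graph: a maximum clique (a clique of size `ω(G)`). -/
abbrev Context (G : SimpleGraph V) : Type u := {c : Finset V // G.IsMaximumClique c}

/-- A `{0,1}`-coloring: at most one `1` on every clique, exactly one on every maximum clique. -/
structure IsZeroOneColoring (G : SimpleGraph V) (f : V → ℕ) : Prop where
  zero_or_one : ∀ v, f v = 0 ∨ f v = 1
  clique_le : ∀ C : Finset V, G.IsClique (C : Set V) → ∑ v ∈ C, f v ≤ 1
  context_eq : ∀ c : Context G, ∃! v, v ∈ c.1 ∧ f v = 1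

/-- A `[0,1]`-assignment: values in `[0,1]` on the vertices that form a probability distribution
on every context. -/
structure IsUnitAssignment (G : SimpleGraph V) (f : V → ℝ) : Prop where
  mem_Icc : ∀ v, f v ∈ Set.Icc (0 : ℝ) 1
  sum_context : ∀ c : Context G, ∑ v ∈ c.1, f v = 1

/-- A faithful orthogonal representation in `ℂ^d`: unit vectors, orthogonal exactly along the
edges, with distinct vertices represented by non-parallel vectors. -/
structure IsFaithfulRep (G : SimpleGraph V) (d : ℕ) (φ : V → EuclideanSpace ℂ (Fin d)) :
    Prop where
  norm_eq_one : ∀ v, ‖φ v‖ = 1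
  orthogonal_iff : ∀ u v, inner ℂ (φ u) (φ v) = 0 ↔ G.Adj u v
  not_parallel : ∀ u v, u ≠ v → ∀ z : ℂ, φ u ≠ z • φ v

/-- An extended `01`-gadget in dimension `d` with distinguished vertices `v₁` and `v₂`. -/
structure IsExtendedGadget (G : SimpleGraph V) (d : ℕ) (v₁ v₂ : V) : Prop where
  colorable : ∃ f : V → ℕ, IsZeroOneColoring G f
  /-- the least dimension of a faithful orthogonal representation is `d` -/
  faithful_dim : IsLeast {n : ℕ | ∃ φ : V → EuclideanSpace ℂ (Fin n), IsFaithfulRep G n φ} d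
  cliqueNum_eq : G.cliqueNum = d
  ne : v₁ ≠ v₂
  not_adj : ¬ G.Adj v₁ v₂
  assignment_lt : ∀ f : V → ℝ, IsUnitAssignment G f → f v₁ + f v₂ < 2

/-- Families `P(a | x = c)` of real numbers, `c` a context and `a` one of its vertices. -/
abbrev BoxSpace (G : SimpleGraph V) : Type u := (c : Context G) → {v : V // v ∈ c.1} → ℝ

/-- A box compatible with `G`: a probability distribution for every context. -/
structure IsBox (G : SimpleGraph V) (P : BoxSpace G) : Prop where
  nonneg : ∀ c a, 0 ≤ P c a
  sum_eq_one : ∀ c, ∑ a, P c a = 1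

/-- A consistent box: the probability of a vertex does not depend on the context. -/
structure IsConsistentBox (G : SimpleGraph V) (P : BoxSpace G) : Prop extends IsBox G P where
  consistent : ∀ (c c' : Context G) (s : V) (hs : s ∈ c.1) (hs' : s ∈ c'.1),
    P c ⟨s, hs⟩ = P c' ⟨s, hs'⟩

/-- A consistent box which in every context is supported on two of the outcomes. -/
structure IsBinaryBox (G : SimpleGraph V) (P : BoxSpace G) : Prop extends
    IsConsistentBox G P where
  binary : ∀ c, ∃ s₁ s₂, s₁ ≠ s₂ ∧ P c s₁ + P c s₂ = 1

/-- The binary consistent boxes `B^{bin-cons}_G`. -/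
def binConsBoxes (G : SimpleGraph V) : Set (BoxSpace G) :=
  convexHull ℝ {P | IsBinaryBox G P}

open Classical in
/-- Local classical postprocessing: in each context `c` the outcome is relabelled by `g c`. -/
noncomputable def relabel (G : SimpleGraph V)
    (g : (c : Context G) → {v : V // v ∈ c.1} → {v : V // v ∈ c.1}) (P : BoxSpace G) :
    BoxSpace G :=
  fun c a => ∑ b with g c b = a, P c b

/-- The fundamentally binary boxes `B^{bin}_G`: mixtures (shared randomness) of the consistent
boxes that arise from binary consistent boxes by local relabelling of the outcomes. -/
def fundBinaryBoxes (G : SimpleGraph V) : Set (BoxSpace G) :=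
  convexHull ℝ {P | IsConsistentBox G P ∧ ∃ Q g, IsBinaryBox G Q ∧ P = relabel G g Q}

/-- The box of Born probabilities `|⟨φ a, ψ⟩|²`. -/
noncomputable def bornBox (G : SimpleGraph V) {d : ℕ} (φ : V → EuclideanSpace ℂ (Fin d))
    (ψ : EuclideanSpace ℂ (Fin d)) : BoxSpace G :=
  fun _ a => ‖inner ℂ (φ a.1) ψ‖ ^ 2

/-- Boxes obtained by measuring, on a pure state of `ℂ^d`, the projectors of a faithful
orthogonal representation of `G` in `ℂ^d`. -/
def quantumBoxes (G : SimpleGraph V) (d : ℕ) : Set (BoxSpace G) :=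
  {P | ∃ φ : V → EuclideanSpace ℂ (Fin d), IsFaithfulRep G d φ ∧
    ∃ ψ : EuclideanSpace ℂ (Fin d), ‖ψ‖ = 1 ∧ P = bornBox G φ ψ}

/-- The expression `P(a = v₁ | x = c₁) + P(a = v₂ | x = c₂)`. -/
def pairValue {G : SimpleGraph V} {v₁ v₂ : V} {c₁ c₂ : Context G}
    (h₁ : v₁ ∈ c₁.1) (h₂ : v₂ ∈ c₂.1) (P : BoxSpace G) : ℝ :=
  P c₁ ⟨v₁, h₁⟩ + P c₂ ⟨v₂, h₂⟩

end Contextuality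

namespace Contextuality

open scoped BigOperators

/-! ### Binary boxes and the bound 3/2 -/

section Boxes

variable {V : Type*} [Fintype V] {G : SimpleGraph V}

/-! The bound 3/2 comes from rounding. In each context a binary box has at most two nonzero
probabilities x and 1 - x. Sending values below, at and above 1/2 to 0, 1/2 and 1 preserves their
sum, so by consistency a binary box rounds to a `[0,1]`-assignment. A pair value above 3/2 would put
both probabilities above 1/2, so both would round to 1, which the gadget forbids. Convexity extends
the bound to mixtures, and a consistent relabelling of a binary box is again binary. On the quantum
side, ψ bisects the angle between the two vectors, so each has probability cos²(θ/2).

For the existence of gadgets, start in three dimensions with (s, ±1, 0), where s² = cot²(θ/2). If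
both have value 1, the vectors `n` orthogonal to them have value 0. With signs σ and τ, `n` is (1,
-σs, -τw). For fixed τ the two `n` are orthogonal when the two w multiply to s² - 1, and a vector
orthogonal to both must then have value 1. With both w equal to s', where s'² = s² - 1, the two
vectors so forced (τ = ±1) are (s', 0, ±1): the initial pair again, with the last two coordinates
exchanged and a larger angle. Iterating brings s² into (1, 2]. One last step, with unequal w, forces
two orthogonal vectors `p` to have value 1, a contradiction (`add_lt_two_of_frames`).

A coloring and exact control of orthogonality remain. Phases z^ℓ keep the intended orthogonalities,
and a generic z on the unit circle destroys the accidental ones between levels (`exists_phase`). All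
surviving ones lie in the explicit relation `Rel`, for which `Positive` is a coloring. Further
dimensions are filled with standard basis vectors, and parallel vectors are identified in
`exists_isExtendedGadget_of_vectors`. -/

theorem IsExtendedGadget.card_context {d : ℕ} {v₁ v₂ : V} (hG : IsExtendedGadget G d v₁ v₂)
    (c : Context G) : c.1.card = d :=
  (G.maximumClique_card_eq_cliqueNum c.1 c.2).trans hG.cliqueNum_eq

omit [Fintype V] in
theorem IsFaithfulRep.two_le {d : ℕ} {φ : V → EuclideanSpace ℂ (Fin d)}
    (hφ : IsFaithfulRep G d φ) {v₁ v₂ : V} (hne : v₁ ≠ v₂) : 2 ≤ d := by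
  by_contra hd
  have hd' : d = 0 ∨ d = 1 := by omega
  rcases hd' with rfl | rfl
  · have h := hφ.norm_eq_one v₁
    rw [Subsingleton.elim (φ v₁) 0, norm_zero] at h
    exact zero_ne_one h
  · have h0 : φ v₂ 0 ≠ 0 := by
      intro h
      have h1 := hφ.norm_eq_one v₂
      have h2 : φ v₂ = 0 := by
        ext i
        rw [Subsingleton.elim i 0, h]
        rfl
      rw [h2, norm_zero] at h1
      exact zero_ne_one h1
    refine hφ.not_parallel v₁ v₂ hne (φ v₁ 0 / φ v₂ 0) ?_
    ext i
    rw [Subsingleton.elim i 0]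
    simp [h0]

theorem IsExtendedGadget.two_le {d : ℕ} {v₁ v₂ : V} (hG : IsExtendedGadget G d v₁ v₂) :
    2 ≤ d := by
  obtain ⟨φ, hφ⟩ := hG.faithful_dim.1
  exact hφ.two_le hG.ne

theorem IsExtendedGadget.exists_ne_mem_context {d : ℕ} {v₁ v₂ : V}
    (hG : IsExtendedGadget G d v₁ v₂) (c : Context G) (a : {v : V // v ∈ c.1}) :
    ∃ b : {v : V // v ∈ c.1}, a ≠ b := by
  have h1 : 1 < c.1.card := by
    rw [hG.card_context c]
    exact hG.two_le
  obtain ⟨b, hb, hne⟩ := Finset.exists_mem_ne h1 a.1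
  exact ⟨⟨b, hb⟩, fun h => hne (congrArg Subtype.val h).symm⟩

/-- A coloring is a deterministic box. It counts as binary because d ≥ 2 supplies a second outcome,
of probability 0, in every context. -/
theorem IsExtendedGadget.binConsBoxes_nonempty {d : ℕ} {v₁ v₂ : V}
    (hG : IsExtendedGadget G d v₁ v₂) : (binConsBoxes G).Nonempty := by
  obtain ⟨f, hf⟩ := hG.colorable
  refine ⟨fun _ a => (f a.1 : ℝ), subset_convexHull ℝ _ ?_⟩
  refine { nonneg := fun _ _ => Nat.cast_nonneg _, sum_eq_one := ?_,
           consistent := fun _ _ _ _ _ => rfl, binary := ?_ }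
  · intro c
    obtain ⟨v, ⟨hv, hv1⟩, huniq⟩ := hf.context_eq c
    rw [Finset.sum_eq_single ⟨v, hv⟩]
    · simp [hv1]
    · rintro ⟨b, hb⟩ - hne
      rcases hf.zero_or_one b with h | h
      · simp [h]
      · exact absurd (Subtype.ext (huniq b ⟨hb, h⟩)) hne
    · simp
  · intro c
    obtain ⟨v, ⟨hv, hv1⟩, huniq⟩ := hf.context_eq c
    obtain ⟨b, hb⟩ := hG.exists_ne_mem_context c ⟨v, hv⟩
    refine ⟨⟨v, hv⟩, b, hb, ?_⟩
    rcases hf.zero_or_one b.1 with h | h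
    · simp [h, hv1]
    · exact absurd (Subtype.ext (huniq b.1 ⟨b.2, h⟩)).symm hb

theorem IsBox.le_one {P : BoxSpace G} (hP : IsBox G P) (c : Context G) (a) : P c a ≤ 1 := by
  rw [← hP.sum_eq_one c]
  exact Finset.single_le_sum (fun b _ => hP.nonneg c b) (Finset.mem_univ a)

theorem IsBox.eq_zero_of_add_eq_one {P : BoxSpace G} (hP : IsBox G P) {c : Context G}
    {s t a : {v : V // v ∈ c.1}} (hst : s ≠ t) (h : P c s + P c t = 1) (has : a ≠ s)
    (hat : a ≠ t) : P c a = 0 := by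
  classical
  have h1 : ∑ b ∈ ({a, s, t} : Finset {v : V // v ∈ c.1}), P c b ≤ 1 := by
    rw [← hP.sum_eq_one c]
    exact Finset.sum_le_sum_of_subset_of_nonneg (Finset.subset_univ _)
      fun b _ _ => hP.nonneg c b
  rw [Finset.sum_insert (by simp [has, hat]), Finset.sum_pair hst] at h1
  have := hP.nonneg c a
  linarith

/-- Rounding of a probability to `0`, `1/2` or `1`. -/
noncomputable def roundHalf (x : ℝ) : ℝ :=
  if x < 1 / 2 then 0 else if x = 1 / 2 then 1 / 2 else 1

theorem roundHalf_mem_Icc (x : ℝ) : roundHalf x ∈ Set.Icc (0 : ℝ) 1 := by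
  unfold roundHalf
  split_ifs <;> constructor <;> norm_num

theorem roundHalf_zero : roundHalf 0 = 0 := by
  simp [roundHalf]

theorem roundHalf_of_half_lt {x : ℝ} (h : 1 / 2 < x) : roundHalf x = 1 := by
  simp only [roundHalf, if_neg h.not_gt, if_neg h.ne']

theorem roundHalf_add_of_add_eq_one {x y : ℝ} (h : x + y = 1) :
    roundHalf x + roundHalf y = 1 := by
  obtain rfl : y = 1 - x := by linarith
  unfold roundHalf
  rcases lt_trichotomy x (1 / 2) with hx | rfl | hx
  · rw [if_pos hx, if_neg (by linarith), if_neg (by linarith), zero_add]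
  · norm_num
  · rw [if_neg (by linarith), if_neg hx.ne', if_pos (by linarith), add_zero]

open Classical in
/-- The function on the vertices obtained by rounding the probabilities of a consistent box. -/
noncomputable def roundedAssignment (P : BoxSpace G) (v : V) : ℝ :=
  -- A vertex outside all contexts is unconstrained, so the default 0 is harmless.
  if h : ∃ c : Context G, v ∈ c.1 then roundHalf (P h.choose ⟨v, h.choose_spec⟩) else 0

theorem IsConsistentBox.roundedAssignment_eq {P : BoxSpace G} (hP : IsConsistentBox G P)
    {c : Context G} {v : V} (hv : v ∈ c.1) :
    roundedAssignment P v = roundHalf (P c ⟨v, hv⟩) := by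
  have h : ∃ c : Context G, v ∈ c.1 := ⟨c, hv⟩
  rw [roundedAssignment, dif_pos h, hP.consistent]

/-- Rounding fixes 0 and commutes with x ↦ 1 - x; the value 1/2 at the midpoint is what makes the
latter true. -/
theorem IsBinaryBox.isUnitAssignment_rounded {P : BoxSpace G} (hP : IsBinaryBox G P) :
    IsUnitAssignment G (roundedAssignment P) where
  mem_Icc v := by
    unfold roundedAssignment
    split_ifs
    · exact roundHalf_mem_Icc _
    · simp
  sum_context c := by
    classical
    obtain ⟨s, t, hst, h⟩ := hP.binary c
    rw [← Finset.sum_coe_sort,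
      Finset.sum_congr rfl fun a _ => hP.toIsConsistentBox.roundedAssignment_eq a.2,
      ← Finset.sum_subset (Finset.subset_univ {s, t}), Finset.sum_pair hst]
    · exact roundHalf_add_of_add_eq_one h
    · intro a _ ha
      simp only [Finset.mem_insert, Finset.mem_singleton, not_or] at ha
      rw [Subtype.coe_eta, hP.toIsBox.eq_zero_of_add_eq_one hst h ha.1 ha.2, roundHalf_zero]

theorem IsExtendedGadget.pairValue_le_of_isBinaryBox {d : ℕ} {v₁ v₂ : V}
    (hG : IsExtendedGadget G d v₁ v₂) {c₁ c₂ : Context G} (h₁ : v₁ ∈ c₁.1) (h₂ : v₂ ∈ c₂.1)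
    {P : BoxSpace G} (hP : IsBinaryBox G P) : pairValue h₁ h₂ P ≤ 3 / 2 := by
  by_contra hlt
  have hlt' : 3 / 2 < P c₁ ⟨v₁, h₁⟩ + P c₂ ⟨v₂, h₂⟩ := not_le.1 hlt
  have hle₁ := hP.toIsBox.le_one c₁ ⟨v₁, h₁⟩
  have hle₂ := hP.toIsBox.le_one c₂ ⟨v₂, h₂⟩
  have h := hG.assignment_lt _ hP.isUnitAssignment_rounded
  rw [hP.toIsConsistentBox.roundedAssignment_eq h₁, hP.toIsConsistentBox.roundedAssignment_eq h₂,
    roundHalf_of_half_lt (by linarith), roundHalf_of_half_lt (by linarith)] at h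
  norm_num at h

theorem convex_pairValue_le {v₁ v₂ : V} {c₁ c₂ : Context G} (h₁ : v₁ ∈ c₁.1) (h₂ : v₂ ∈ c₂.1)
    (r : ℝ) : Convex ℝ {P : BoxSpace G | pairValue h₁ h₂ P ≤ r} := by
  intro P hP Q hQ a b ha hb hab
  simp only [Set.mem_ofPred_eq, pairValue, Pi.add_apply, Pi.smul_apply, smul_eq_mul] at *
  obtain rfl : b = 1 - a := by linarith
  nlinarith

theorem IsExtendedGadget.pairValue_le_of_mem_binConsBoxes {d : ℕ} {v₁ v₂ : V}
    (hG : IsExtendedGadget G d v₁ v₂) {c₁ c₂ : Context G} (h₁ : v₁ ∈ c₁.1) (h₂ : v₂ ∈ c₂.1)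
    {P : BoxSpace G} (hP : P ∈ binConsBoxes G) : pairValue h₁ h₂ P ≤ 3 / 2 :=
  convexHull_min (fun _ hQ => hG.pairValue_le_of_isBinaryBox h₁ h₂ hQ)
    (convex_pairValue_le h₁ h₂ _) hP

/-- The mass sits on the images of the two supporting outcomes. If these coincide, any other outcome
serves as the second one. -/
theorem IsExtendedGadget.isBinaryBox_relabel {d : ℕ} {v₁ v₂ : V}
    (hG : IsExtendedGadget G d v₁ v₂) {Q : BoxSpace G} (hQ : IsBinaryBox G Q)
    (g : (c : Context G) → {v : V // v ∈ c.1} → {v : V // v ∈ c.1})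
    (hcons : IsConsistentBox G (relabel G g Q)) : IsBinaryBox G (relabel G g Q) where
  toIsConsistentBox := hcons
  binary c := by
    classical
    obtain ⟨s, t, hst, h⟩ := hQ.binary c
    have hnn := hcons.nonneg c
    by_cases hg : g c s = g c t
    · obtain ⟨b, hb⟩ := hG.exists_ne_mem_context c (g c s)
      refine ⟨g c s, b, hb, ?_⟩
      have h1 : 1 ≤ relabel G g Q c (g c s) := by
        rw [← h, ← Finset.sum_pair hst]
        refine Finset.sum_le_sum_of_subset_of_nonneg ?_ fun b _ _ => hQ.nonneg c b
        intro x hx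
        rcases Finset.mem_insert.1 hx with rfl | hx
        · simp
        · simp [Finset.mem_singleton.1 hx, hg]
      have h2 : ∑ x ∈ ({g c s, b} : Finset _), relabel G g Q c x ≤ 1 := by
        rw [← hcons.sum_eq_one c]
        exact Finset.sum_le_sum_of_subset_of_nonneg (Finset.subset_univ _) fun b _ _ => hnn b
      rw [Finset.sum_pair hb] at h2
      linarith [hnn b]
    · refine ⟨g c s, g c t, hg, ?_⟩
      have key : ∀ x, Q c x ≤ relabel G g Q c (g c x) := fun x =>
        Finset.single_le_sum (f := fun b => Q c b) (fun b _ => hQ.nonneg c b) (by simp)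
      have h2 : ∑ x ∈ ({g c s, g c t} : Finset _), relabel G g Q c x ≤ 1 := by
        rw [← hcons.sum_eq_one c]
        exact Finset.sum_le_sum_of_subset_of_nonneg (Finset.subset_univ _) fun b _ _ => hnn b
      rw [Finset.sum_pair hg] at h2
      linarith [key s, key t]

theorem IsExtendedGadget.fundBinaryBoxes_subset {d : ℕ} {v₁ v₂ : V}
    (hG : IsExtendedGadget G d v₁ v₂) : fundBinaryBoxes G ⊆ binConsBoxes G := by
  refine convexHull_mono ?_
  rintro _ ⟨hcons, Q, g, hQ, rfl⟩
  exact hG.isBinaryBox_relabel hQ g hcons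

/-! ### Algebraic maximum and quantum value -/

theorem exists_isBox_apply_eq_one (w : (c : Context G) → {v : V // v ∈ c.1}) :
    ∃ P, IsBox G P ∧ ∀ c, P c (w c) = 1 := by
  classical
  refine ⟨fun c a => if a = w c then 1 else 0, ⟨fun c a => ?_, fun c => by simp⟩, by simp⟩
  split_ifs <;> norm_num

theorem IsExtendedGadget.isGreatest_pairValue {d : ℕ} {v₁ v₂ : V}
    (hG : IsExtendedGadget G d v₁ v₂) {c₁ c₂ : Context G} (h₁ : v₁ ∈ c₁.1) (h₂ : v₂ ∈ c₂.1) :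
    IsGreatest (pairValue h₁ h₂ '' {P | IsBox G P}) 2 := by
  classical
  constructor
  -- Non-adjacency keeps `v₁` and `v₂` out of a common context, so one deterministic choice can
  -- select each wherever it occurs.
  · have hv : ∀ c : Context G, ∃ a : {v : V // v ∈ c.1},
        (∀ h : v₁ ∈ c.1, a = ⟨v₁, h⟩) ∧ (∀ h : v₂ ∈ c.1, a = ⟨v₂, h⟩) := by
      intro c
      by_cases hm₁ : v₁ ∈ c.1
      · exact ⟨⟨v₁, hm₁⟩, fun _ => rfl,
          fun hm₂ => absurd (c.2.isClique hm₁ hm₂ hG.ne) hG.not_adj⟩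
      · by_cases hm₂ : v₂ ∈ c.1
        · exact ⟨⟨v₂, hm₂⟩, fun h => absurd h hm₁, fun _ => rfl⟩
        · have hpos : 0 < c.1.card := by
            rw [hG.card_context c]
            linarith [hG.two_le]
          obtain ⟨a, ha⟩ := Finset.card_pos.1 hpos
          exact ⟨⟨a, ha⟩, fun h => absurd h hm₁, fun h => absurd h hm₂⟩
    choose w hw₁ hw₂ using hv
    obtain ⟨P, hP, hP1⟩ := exists_isBox_apply_eq_one w
    refine ⟨P, hP, ?_⟩
    rw [pairValue, ← hw₁ c₁ h₁, ← hw₂ c₂ h₂, hP1, hP1]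
    norm_num
  · rintro _ ⟨P, hP, rfl⟩
    have := hP.le_one c₁ ⟨v₁, h₁⟩
    have := hP.le_one c₂ ⟨v₂, h₂⟩
    rw [pairValue]
    linarith

/-- A context has d pairwise orthogonal unit vectors, hence is an orthonormal basis, and
normalization is Parseval's identity. -/
theorem isConsistentBox_bornBox {d : ℕ} {φ : V → EuclideanSpace ℂ (Fin d)}
    (hφ : IsFaithfulRep G d φ) (hd : G.cliqueNum = d) {ψ : EuclideanSpace ℂ (Fin d)}
    (hψ : ‖ψ‖ = 1) : IsConsistentBox G (bornBox G φ ψ) where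
  nonneg _ _ := sq_nonneg _
  consistent _ _ _ _ _ := rfl
  sum_eq_one c := by
    have hon : Orthonormal ℂ fun a : {v : V // v ∈ c.1} => φ a.1 :=
      ⟨fun a => hφ.norm_eq_one a.1, fun a b hab =>
        (hφ.orthogonal_iff _ _).2 (c.2.isClique a.2 b.2 fun h => hab (Subtype.ext h))⟩
    have hcard : Fintype.card {v : V // v ∈ c.1} = Module.finrank ℂ (EuclideanSpace ℂ (Fin d)) := by
      rw [finrank_euclideanSpace_fin, Fintype.card_coe,
        G.maximumClique_card_eq_cliqueNum c.1 c.2, hd]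
    rcases isEmpty_or_nonempty {v : V // v ∈ c.1} with hemp | hne
    · exfalso
      have : d = 0 := by simpa using hcard.symm
      subst this
      rw [Subsingleton.elim ψ 0, norm_zero] at hψ
      exact zero_ne_one hψ
    · let b := OrthonormalBasis.mk hon
        (ge_of_eq ((basisOfLinearIndependentOfCardEqFinrank hon.linearIndependent hcard).span_eq ▸
          by simp))
      have := b.sum_sq_norm_inner_right ψ
      simp only [b, OrthonormalBasis.coe_mk, hψ, one_pow] at this
      exact this

theorem norm_inner_add_sq {E : Type*} [NormedAddCommGroup E] [InnerProductSpace ℂ E] {x y : E}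
    {c : ℝ} (hx : ‖x‖ = 1) (hy : ‖y‖ = 1) (hxy : inner ℂ x y = (c : ℂ)) (hc : -1 < c) {ψ : E}
    (hψ : ψ = ((1 / √(2 * (1 + c)) : ℝ) : ℂ) • (x + y)) :
    ‖ψ‖ = 1 ∧ ‖inner ℂ x ψ‖ ^ 2 = (1 + c) / 2 ∧ ‖inner ℂ y ψ‖ ^ 2 = (1 + c) / 2 := by
  have hpos : 0 < 2 * (1 + c) := by linarith
  have hxx : inner ℂ x x = (1 : ℂ) := by rw [inner_self_eq_norm_sq_to_K, hx]; simp
  have hyy : inner ℂ y y = (1 : ℂ) := by rw [inner_self_eq_norm_sq_to_K, hy]; simp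
  have hyx : inner ℂ y x = (c : ℂ) := by rw [← inner_conj_symm, hxy, Complex.conj_ofReal]
  have hs : √(2 * (1 + c)) ^ 2 = 2 * (1 + c) := Real.sq_sqrt hpos.le
  have hs0 : √(2 * (1 + c)) ≠ 0 := (Real.sqrt_pos.2 hpos).ne'
  have hn : ‖ψ‖ ^ 2 = 1 := by
    have h : inner ℂ ψ ψ = (1 : ℂ) := by
      rw [hψ, inner_smul_left, inner_smul_right, inner_add_left, inner_add_right, inner_add_right,
        hxx, hyy, hxy, hyx, Complex.conj_ofReal]
      norm_cast
      field_simp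
      rw [hs]
      ring
    rw [inner_self_eq_norm_sq_to_K] at h
    have h' : ((‖ψ‖ ^ 2 : ℝ) : ℂ) = 1 := by
      push_cast
      exact h
    exact_mod_cast h'
  refine ⟨by nlinarith [norm_nonneg ψ, sq_nonneg (‖ψ‖ - 1)], ?_, ?_⟩
  · rw [hψ, inner_smul_right, inner_add_right, hxx, hxy]
    norm_cast
    rw [Real.norm_eq_abs, sq_abs]
    field_simp
    rw [hs]
    ring
  · rw [hψ, inner_smul_right, inner_add_right, hyy, hyx]
    norm_cast
    rw [Real.norm_eq_abs, sq_abs]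
    field_simp
    rw [hs]
    ring

theorem IsExtendedGadget.quantum_value {d : ℕ} {v₁ v₂ : V} (hG : IsExtendedGadget G d v₁ v₂)
    {c₁ c₂ : Context G} (h₁ : v₁ ∈ c₁.1) (h₂ : v₂ ∈ c₂.1) {θ : ℝ}
    (hθ : θ ∈ Set.Ioo 0 (Real.pi / 2)) {φ : V → EuclideanSpace ℂ (Fin d)}
    (hφ : IsFaithfulRep G d φ) (hin : inner ℂ (φ v₁) (φ v₂) = (Real.cos θ : ℂ))
    {ψ : EuclideanSpace ℂ (Fin d)}
    (hψ : ψ = ((1 / Real.sqrt (2 * (1 + Real.cos θ)) : ℝ) : ℂ) • (φ v₁ + φ v₂)) :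
    ‖ψ‖ = 1 ∧ IsConsistentBox G (bornBox G φ ψ) ∧
      pairValue h₁ h₂ (bornBox G φ ψ) = 1 + Real.cos θ := by
  have hc : 0 < Real.cos θ := Real.cos_pos_of_mem_Ioo ⟨by linarith [hθ.1, hθ.2], hθ.2⟩
  obtain ⟨hn, hx, hy⟩ := norm_inner_add_sq (hφ.norm_eq_one v₁) (hφ.norm_eq_one v₂) hin
    (by linarith) hψ
  refine ⟨hn, isConsistentBox_bornBox hφ hG.cliqueNum_eq hn, ?_⟩
  simp only [pairValue, bornBox, hx, hy]
  ring

end Boxes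

end Contextuality

namespace Contextuality

/-! ### From vector configurations to gadgets -/

section VectorConfigurations

/-- A section of an equivalence relation on a finite type with two prescribed representatives. -/
theorem exists_transversal {ι : Type*} [Finite ι] (s : Setoid ι) {i₁ i₂ : ι} (hne : ¬ s i₁ i₂) :
    ∃ (n : ℕ) (r : Fin n → ι) (c : ι → Fin n), (∀ i, s i (r (c i))) ∧ (∀ m, c (r m) = m) ∧
      (∀ i j, s i j → c i = c j) ∧ r (c i₁) = i₁ ∧ r (c i₂) = i₂ ∧ c i₁ ≠ c i₂ := by
  classical
  obtain ⟨n, ⟨e⟩⟩ := Finite.exists_equiv_fin (Quotient s)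
  have h12 : (Quotient.mk s i₁) ≠ Quotient.mk s i₂ := fun h => hne (Quotient.exact h)
  have hex : ∀ m : Quotient s, ∃ i, Quotient.mk s i = m ∧ (m = Quotient.mk s i₁ → i = i₁) ∧
      (m = Quotient.mk s i₂ → i = i₂) := by
    intro m
    by_cases h1 : m = Quotient.mk s i₁
    · exact ⟨i₁, h1.symm, fun _ => rfl, fun h => absurd (h1.symm.trans h) h12⟩
    · by_cases h2 : m = Quotient.mk s i₂
      · exact ⟨i₂, h2.symm, fun h => absurd h h1, fun _ => rfl⟩
      · exact ⟨m.out, m.out_eq, fun h => absurd h h1, fun h => absurd h h2⟩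
  choose r hr hr1 hr2 using hex
  refine ⟨n, fun m => r (e.symm m), fun i => e (Quotient.mk s i), fun i => ?_, fun m => ?_,
    fun i j h => congrArg e (Quotient.sound h), ?_, ?_, fun h => h12 (e.injective h)⟩
  · simp only [Equiv.symm_apply_apply]
    exact Quotient.exact (hr _).symm
  · simp [hr]
  · simp only [Equiv.symm_apply_apply]
    exact hr1 _ rfl
  · simp only [Equiv.symm_apply_apply]
    exact hr2 _ rfl

/-- Parallelism of the members of a family of vectors. -/
def parallelSetoid {ι E : Type*} [AddCommGroup E] [Module ℂ E] (x : ι → E) : Setoid ι where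
  r i j := ∃ z : ℂ, z ≠ 0 ∧ x i = z • x j
  iseqv :=
    { refl := fun i => ⟨1, one_ne_zero, (one_smul _ _).symm⟩
      symm := by
        rintro i j ⟨z, hz, h⟩
        exact ⟨z⁻¹, inv_ne_zero hz, by rw [h, inv_smul_smul₀ hz]⟩
      trans := by
        rintro i j k ⟨z, hz, h⟩ ⟨w, hw, h'⟩
        exact ⟨z * w, mul_ne_zero hz hw, by rw [h, h', mul_smul]⟩ }

variable {V : Type*} {G : SimpleGraph V}

/-- Orthonormal vectors are independent. This makes frames maximum cliques and also bounds the
dimension of any faithful representation from below. -/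
theorem IsFaithfulRep.card_le_of_isClique {d : ℕ} {φ : V → EuclideanSpace ℂ (Fin d)}
    (hφ : IsFaithfulRep G d φ) {C : Finset V} (hC : G.IsClique (C : Set V)) : C.card ≤ d := by
  have hon : Orthonormal ℂ fun a : {v : V // v ∈ C} => φ a.1 :=
    ⟨fun a => hφ.norm_eq_one a.1, fun a b hab =>
      (hφ.orthogonal_iff _ _).2 (hC a.2 b.2 fun h => hab (Subtype.ext h))⟩
  have := hon.linearIndependent.fintype_card_le_finrank
  rwa [finrank_euclideanSpace_fin, Fintype.card_coe] at this

/-- A family of pairwise orthogonal members of a configuration of `d` vectors in `ℂ^d`. -/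
def IsOrthogonalFrame {ι : Type*} {d : ℕ} (x : ι → EuclideanSpace ℂ (Fin d)) (T : Finset ι) :
    Prop :=
  T.card = d ∧ ∀ i ∈ T, ∀ j ∈ T, i ≠ j → inner ℂ (x i) (x j) = 0

/-- A finite configuration of vectors with a positive set that meets every orthogonal frame and
contains no orthogonal pair gives an extended gadget, if no weight on the frames has the value
`1` on both distinguished vectors. -/
theorem exists_isExtendedGadget_of_vectors {ι : Type*} [Finite ι] {d : ℕ}
    (x : ι → EuclideanSpace ℂ (Fin d)) (hx : ∀ i, x i ≠ 0) (A : Set ι)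
    (hA : ∀ i ∈ A, ∀ j ∈ A, inner ℂ (x i) (x j) ≠ 0)
    (hT : ∀ T, IsOrthogonalFrame x T → ∃ i ∈ T, i ∈ A) {i₁ i₂ : ι} {T₁ T₂ : Finset ι}
    (hT₁ : IsOrthogonalFrame x T₁) (hT₂ : IsOrthogonalFrame x T₂) (hi₁ : i₁ ∈ T₁) (hi₂ : i₂ ∈ T₂)
    {c : ℝ} (hc₀ : 0 < c) (hc₁ : c < 1) (hin : inner ℂ (x i₁) (x i₂) = ((c * (‖x i₁‖ * ‖x i₂‖) : ℝ) : ℂ))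
    (hg : ∀ g : ι → ℝ, (∀ i, g i ∈ Set.Icc (0 : ℝ) 1) →
      (∀ T, IsOrthogonalFrame x T → ∑ i ∈ T, g i = 1) → g i₁ + g i₂ < 2) :
    ∃ (n : ℕ) (G : SimpleGraph (Fin n)) (v₁ v₂ : Fin n), IsExtendedGadget G d v₁ v₂ ∧
      (∃ c₁ : Context G, v₁ ∈ c₁.1) ∧ (∃ c₂ : Context G, v₂ ∈ c₂.1) ∧
      ∃ φ : Fin n → EuclideanSpace ℂ (Fin d), IsFaithfulRep G d φ ∧
        inner ℂ (φ v₁) (φ v₂) = (c : ℂ) := by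
  classical
  have hn : ∀ i, 0 < ‖x i‖ := fun i => norm_pos_iff.2 (hx i)
  have hn' : ∀ i, (‖x i‖ : ℂ) ≠ 0 := fun i => by exact_mod_cast (hn i).ne'
  -- Parallel vectors would give equality in Cauchy–Schwarz, against c < 1.
  have hnp : ¬ parallelSetoid x i₁ i₂ := by
    rintro ⟨z, -, hz⟩
    have h1 : ‖inner ℂ (x i₁) (x i₂)‖ = ‖x i₁‖ * ‖x i₂‖ := by
      rw [hz, inner_smul_left, norm_mul, RCLike.norm_conj, inner_self_eq_norm_sq_to_K, norm_smul]
      simp [sq, mul_assoc]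
    have hpos : 0 < ‖x i₁‖ * ‖x i₂‖ := mul_pos (hn _) (hn _)
    rw [hin, Complex.norm_real, Real.norm_of_nonneg (by positivity)] at h1
    nlinarith
  -- Keeping i₁ and i₂ as representatives makes the final inner product exactly c, without an extra
  -- phase.
  obtain ⟨n, r, k, hrk, hkr, hks, hr₁, hr₂, hk⟩ := exists_transversal (parallelSetoid x) hnp
  have horth : ∀ i j, inner ℂ (x (r (k i))) (x (r (k j))) = 0 ↔ inner ℂ (x i) (x j) = 0 := by
    intro i j
    obtain ⟨z, hz, hi⟩ := hrk i
    obtain ⟨w, hw, hj⟩ := hrk j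
    rw [hi, hj, inner_smul_left, inner_smul_right]
    simp [hz, hw]
  have hself : ∀ i, inner ℂ (x i) (x i) ≠ 0 := fun i => inner_self_ne_zero.2 (hx i)
  let G : SimpleGraph (Fin n) :=
    { Adj := fun m m' => inner ℂ (x (r m)) (x (r m')) = 0
      symm := ⟨fun m m' h => inner_eq_zero_symm.1 h⟩
      loopless := ⟨fun m => hself _⟩ }
  have hadj : ∀ i j, G.Adj (k i) (k j) ↔ inner ℂ (x i) (x j) = 0 := horth
  let φ : Fin n → EuclideanSpace ℂ (Fin d) := fun m => ((‖x (r m)‖⁻¹ : ℝ) : ℂ) • x (r m)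
  have hφ : IsFaithfulRep G d φ := by
    refine ⟨fun m => ?_, fun m m' => ?_, fun m m' hne z hz => ?_⟩
    · rw [norm_smul, Complex.norm_real, Real.norm_of_nonneg (by positivity),
        inv_mul_cancel₀ (hn _).ne']
    · simp only [φ, inner_smul_left, inner_smul_right]
      simp [hn', G]
    · refine hne ?_
      have h1 : x (r m) = ((‖x (r m)‖ : ℂ) * z * ((‖x (r m')‖⁻¹ : ℝ) : ℂ)) • x (r m') := by
        have h2 : x (r m) = (‖x (r m)‖ : ℂ) • φ m := by
          simp only [φ, smul_smul]
          push_cast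
          rw [mul_inv_cancel₀ (hn' _), one_smul]
        refine h2.trans ?_
        rw [hz]
        simp only [φ, smul_smul, mul_assoc]
      have h0 : ((‖x (r m)‖ : ℂ) * z * ((‖x (r m')‖⁻¹ : ℝ) : ℂ)) ≠ 0 := by
        intro h
        rw [h, zero_smul] at h1
        exact hx _ h1
      rw [← hkr m, ← hkr m']
      exact hks _ _ ⟨_, h0, h1⟩
  have hframe : ∀ T, IsOrthogonalFrame x T → Set.InjOn k T ∧ G.IsClique (T.image k : Set (Fin n)) ∧
      (T.image k).card = d := by
    intro T hT
    have hinj : Set.InjOn k T := by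
      intro i hi j hj hij
      by_contra hne
      have h := (hadj i j).2 (hT.2 i hi j hj hne)
      rw [hij] at h
      exact G.loopless.irrefl _ h
    refine ⟨hinj, ?_, by rw [Finset.card_image_of_injOn hinj, hT.1]⟩
    intro m hm m' hm' hne
    obtain ⟨i, hi, rfl⟩ := Finset.mem_image.1 hm
    obtain ⟨j, hj, rfl⟩ := Finset.mem_image.1 hm'
    exact (hadj i j).2 (hT.2 i hi j hj fun h => hne (h ▸ rfl))
  have hmax : ∀ T, IsOrthogonalFrame x T → G.IsMaximumClique (T.image k) := fun T hT =>
    ⟨(hframe T hT).2.1, fun C hC => (hφ.card_le_of_isClique hC).trans (hframe T hT).2.2.ge⟩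
  have hcl : G.cliqueNum = d :=
    (G.maximumClique_card_eq_cliqueNum _ (hmax T₁ hT₁)).symm.trans (hframe T₁ hT₁).2.2
  have hctx : ∀ C : Context G, IsOrthogonalFrame x (C.1.image r) := by
    intro C
    have hrinj : Function.Injective r := fun m m' h => by rw [← hkr m, h, hkr]
    refine ⟨?_, ?_⟩
    · rw [Finset.card_image_of_injective _ hrinj, G.maximumClique_card_eq_cliqueNum C.1 C.2, hcl]
    · intro i hi j hj hij
      obtain ⟨m, hm, rfl⟩ := Finset.mem_image.1 hi
      obtain ⟨m', hm', rfl⟩ := Finset.mem_image.1 hj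
      exact C.2.isClique hm hm' fun h => hij (h ▸ rfl)
  refine ⟨n, G, k i₁, k i₂, ⟨?_, ⟨⟨φ, hφ⟩, ?_⟩, hcl, hk, ?_, ?_⟩,
    ⟨⟨_, hmax T₁ hT₁⟩, Finset.mem_image_of_mem k hi₁⟩,
    ⟨⟨_, hmax T₂ hT₂⟩, Finset.mem_image_of_mem k hi₂⟩, φ, hφ, ?_⟩
  · have huniq : ∀ C : Finset (Fin n), G.IsClique (C : Set (Fin n)) → ∀ m ∈ C, ∀ m' ∈ C,
        (∃ i ∈ A, k i = m) → (∃ i ∈ A, k i = m') → m = m' := by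
      rintro C hC _ hm _ hm' ⟨i, hi, rfl⟩ ⟨j, hj, rfl⟩
      by_contra hne
      exact hA i hi j hj ((hadj i j).1 (hC hm hm' hne))
    -- A parallel class gets value 1 when it meets A; orthogonality depends only on classes.
    refine ⟨fun m => if ∃ i ∈ A, k i = m then 1 else 0, ⟨fun m => ?_, fun C hC => ?_, fun C => ?_⟩⟩
    · split_ifs <;> simp
    · rw [Finset.sum_boole, Nat.cast_id, Finset.card_le_one]
      intro m hm m' hm'
      rw [Finset.mem_filter] at hm hm'
      exact huniq C hC m hm.1 m' hm'.1 hm.2 hm'.2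
    · obtain ⟨i, hi, hiA⟩ := hT _ (hctx C)
      obtain ⟨m, hm, rfl⟩ := Finset.mem_image.1 hi
      have hmA : ∃ i ∈ A, k i = m := ⟨r m, hiA, hkr m⟩
      refine ⟨m, ⟨hm, if_pos hmA⟩, ?_⟩
      rintro m' ⟨hm', hm'A⟩
      refine huniq C.1 C.2.isClique m' hm' m hm ?_ hmA
      by_contra h
      simp [h] at hm'A
  · rintro e ⟨χ, hχ⟩
    rw [← (hframe T₁ hT₁).2.2]
    exact hχ.card_le_of_isClique (hframe T₁ hT₁).2.1
  · rw [hadj, hin]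
    exact_mod_cast (mul_pos hc₀ (mul_pos (hn _) (hn _))).ne'
  · intro f hf
    refine hg (fun i => f (k i)) (fun i => hf.mem_Icc _) fun T hT => ?_
    rw [← hf.sum_context ⟨_, hmax T hT⟩]
    exact (Finset.sum_image (hframe T hT).1).symm
  · simp only [φ, hr₁, hr₂, inner_smul_left, inner_smul_right, hin, Complex.conj_ofReal]
    norm_cast
    field_simp [(hn i₁).ne', (hn i₂).ne']

end VectorConfigurations

end Contextuality

namespace Contextuality

open Polynomial

/-! ### Phases that destroy accidental orthogonality -/

section PhasedVectors

/-- Finitely many nonzero polynomials have a common non-root on the unit circle. -/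
theorem exists_norm_eq_one_eval_ne_zero {κ : Type*} [Finite κ] (P : κ → ℂ[X]) :
    ∃ z : ℂ, ‖z‖ = 1 ∧ ∀ k, P k ≠ 0 → (P k).eval z ≠ 0 := by
  classical
  have hinf : (Metric.sphere (0 : ℂ) 1).Infinite := by
    refine Set.Infinite.mono (s := (fun t : ℝ => Complex.exp (t * Complex.I)) '' Set.Icc 0 1) ?_ ?_
    · rintro _ ⟨t, -, rfl⟩
      simp [Complex.norm_exp_ofReal_mul_I]
    · refine Set.Infinite.image ?_ (Set.Icc_infinite zero_lt_one)
      intro s hs t ht hst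
      have h := congrArg Complex.re hst
      simp only [Complex.exp_ofReal_mul_I_re] at h
      have hpi := Real.pi_gt_three
      exact Real.injOn_cos ⟨hs.1, by linarith [hs.2]⟩ ⟨ht.1, by linarith [ht.2]⟩ h
  have hfin : (⋃ k ∈ {k | P k ≠ 0}, {z : ℂ | (P k).IsRoot z}).Finite :=
    Set.Finite.biUnion (Set.toFinite _) fun k hk => Polynomial.finite_setOfPred_isRoot hk
  obtain ⟨z, hz, hz'⟩ := (hinf.sdiff hfin).nonempty
  refine ⟨z, by simpa using hz, fun k hk h => hz' ?_⟩
  simp only [Set.mem_iUnion]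
  exact ⟨k, hk, h⟩

/-- The vector of `ℂ^(e+3)` with real first coordinate `x 0` and with the two next coordinates
`x 1 * z ^ ℓ` and `x 2 * z ^ (ℓ + 1)`, in the order given by the parity of `ℓ`. -/
noncomputable def phasedVec (e : ℕ) (z : ℂ) (ℓ : ℕ) (x : Fin 3 → ℝ) :
    EuclideanSpace ℂ (Fin (e + 3)) :=
  WithLp.toLp 2 (Matrix.vecCons (x 0 : ℂ) (Matrix.vecCons
    (if Even ℓ then x 1 * z ^ ℓ else x 2 * z ^ (ℓ + 1))
    (Matrix.vecCons (if Even ℓ then x 2 * z ^ (ℓ + 1) else x 1 * z ^ ℓ) fun _ => 0)))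

/-- The polynomial whose value at `z` is the inner product of two phased vectors. -/
noncomputable def phasedPoly (ℓ m : ℕ) (x y : Fin 3 → ℝ) : ℂ[X] :=
  if Even (m - ℓ) then
    C ((x 0 * y 0 : ℝ) : ℂ) + C ((x 1 * y 1 + x 2 * y 2 : ℝ) : ℂ) * X ^ (m - ℓ)
  else
    C ((x 0 * y 0 : ℝ) : ℂ) + C ((x 2 * y 1 : ℝ) : ℂ) * X ^ (m - ℓ - 1) +
      C ((x 1 * y 2 : ℝ) : ℂ) * X ^ (m - ℓ + 1)

theorem inner_phasedVec_self (e : ℕ) {z : ℂ} (hz : ‖z‖ = 1) (ℓ : ℕ) (x y : Fin 3 → ℝ) :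
    inner ℂ (phasedVec e z ℓ x) (phasedVec e z ℓ y) =
      ((x 0 * y 0 + x 1 * y 1 + x 2 * y 2 : ℝ) : ℂ) := by
  have hzz : (starRingEnd ℂ) z * z = 1 := by
    rw [Complex.conj_mul', hz]
    simp
  have hp : ∀ k, (starRingEnd ℂ) z ^ k * z ^ k = 1 := fun k => by rw [← mul_pow, hzz, one_pow]
  simp only [phasedVec, EuclideanSpace.inner_eq_star_dotProduct, dotProduct, Fin.sum_univ_succ]
  split_ifs <;> simp
  · linear_combination (x 1 * y 1 : ℂ) * hp ℓ + (x 2 * y 2 : ℂ) * hp (ℓ + 1)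
  · linear_combination (x 1 * y 1 : ℂ) * hp ℓ + (x 2 * y 2 : ℂ) * hp (ℓ + 1)

theorem inner_phasedVec (e : ℕ) {z : ℂ} (hz : ‖z‖ = 1) {ℓ m : ℕ} (h : ℓ < m) (x y : Fin 3 → ℝ) :
    inner ℂ (phasedVec e z ℓ x) (phasedVec e z m y) = (phasedPoly ℓ m x y).eval z := by
  have hzz : (starRingEnd ℂ) z * z = 1 := by
    rw [Complex.conj_mul', hz]
    simp
  have hp : ∀ k, (starRingEnd ℂ) z ^ k * z ^ k = 1 := fun k => by rw [← mul_pow, hzz, one_pow]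
  obtain ⟨k, rfl⟩ := Nat.exists_eq_add_of_lt h
  have e1 : ℓ + k + 1 - ℓ = k + 1 := by omega
  rw [phasedPoly, e1]
  simp only [phasedVec, EuclideanSpace.inner_eq_star_dotProduct, dotProduct, Fin.sum_univ_succ]
  by_cases h1 : Even ℓ <;> by_cases h2 : Even k <;> simp [h1, h2, Nat.even_add_one, Nat.even_add]
  · linear_combination (x 2 * y 1 : ℂ) * z ^ k * hp (ℓ + 1) + (x 1 * y 2 : ℂ) * z ^ (k + 2) * hp ℓ
  · linear_combination (x 1 * y 1 : ℂ) * z ^ (k + 1) * hp ℓ +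
      (x 2 * y 2 : ℂ) * z ^ (k + 1) * hp (ℓ + 1)
  · linear_combination (x 2 * y 1 : ℂ) * z ^ k * hp (ℓ + 1) + (x 1 * y 2 : ℂ) * z ^ (k + 2) * hp ℓ
  · linear_combination (x 1 * y 1 : ℂ) * z ^ (k + 1) * hp ℓ +
      (x 2 * y 2 : ℂ) * z ^ (k + 1) * hp (ℓ + 1)

/-- For adjacent levels the exponent m - ℓ - 1 is 0, so the x₂y₁ term joins the constant
coefficient; this is how the intended orthogonality between consecutive levels survives. -/
theorem phasedPoly_succ_eq_zero {ℓ : ℕ} {x y : Fin 3 → ℝ} (h : phasedPoly ℓ (ℓ + 1) x y = 0) :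
    x 0 * y 0 + x 2 * y 1 = 0 ∧ x 1 * y 2 = 0 := by
  have e1 : ℓ + 1 - ℓ = 1 := by omega
  rw [phasedPoly, e1, if_neg (by simp)] at h
  have h0 := congrArg (fun p => coeff p 0) h
  have h2 := congrArg (fun p => coeff p 2) h
  simp only [coeff_add, coeff_C_mul, coeff_X_pow, coeff_C, coeff_zero] at h0 h2
  norm_num at h0 h2
  constructor
  · exact_mod_cast h0
  · rcases h2 with h2 | h2 <;> simp [h2]

theorem phasedPoly_eq_zero {ℓ m : ℕ} (hlm : ℓ + 1 < m) {x y : Fin 3 → ℝ}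
    (h : phasedPoly ℓ m x y = 0) :
    x 0 * y 0 = 0 ∧ (x 1 * y 1 + x 2 * y 2 = 0 ∨ x 2 * y 1 = 0) := by
  obtain ⟨k, rfl⟩ := Nat.exists_eq_add_of_lt hlm
  have e1 : ℓ + 1 + k + 1 - ℓ = k + 2 := by omega
  have h0 := congrArg (fun p => coeff p 0) h
  rw [phasedPoly, e1] at h h0
  split_ifs at h h0 with hev
  · have h2 := congrArg (fun p => coeff p (k + 2)) h
    simp only [coeff_add, coeff_C_mul, coeff_X_pow, coeff_C, coeff_zero] at h0 h2
    norm_num at h0 h2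
    exact ⟨mul_eq_zero.2 h0, Or.inl (by exact_mod_cast h2)⟩
  · have hk : k ≠ 0 := by
      rintro rfl
      simp at hev
    obtain ⟨j, rfl⟩ := Nat.exists_eq_succ_of_ne_zero hk
    have h2 := congrArg (fun p => coeff p (j + 2)) h
    simp only [coeff_add, coeff_C_mul, coeff_X_pow, coeff_C, coeff_zero] at h0 h2
    norm_num at h0 h2
    exact ⟨mul_eq_zero.2 h0, Or.inr (mul_eq_zero.2 h2)⟩

end PhasedVectors

end Contextuality

namespace Contextuality

/-! ### The chain: data, coloring and orthogonality relation -/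

section Chain

/-- The sign attached to a Boolean. -/
def sgn (σ : Bool) : ℝ := if σ then 1 else -1

theorem sgn_true : sgn true = 1 := rfl

theorem sgn_false : sgn false = -1 := rfl

theorem sgn_mul_self (σ : Bool) : sgn σ * sgn σ = 1 := by cases σ <;> norm_num [sgn]

/-- The numerical data of a chain of `N + 1` gadgets. -/
structure ChainData (N : ℕ) where
  s : ℕ → ℝ
  w : ℕ → Bool → ℝ
  a : ℝ
  b : ℝ
  one_lt : ∀ i ≤ N, 1 < s i
  w_pos : ∀ i ≤ N, ∀ σ, 0 < w i σ
  -- Makes `n i true τ` and `n i false τ` orthogonal.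
  w_mul : ∀ i ≤ N, ∀ σ, w i σ * w i (!σ) = s i ^ 2 - 1
  -- Excludes the accidental case w² = s² + 1, where `n i σ true` and `n i σ false` would be
  -- orthogonal.
  w_sq_lt : ∀ i ≤ N, ∀ σ, w i σ ^ 2 < s i ^ 2 + 1
  w_of_lt : ∀ i < N, ∀ σ, w i σ = s (i + 1)
  s_succ : ∀ i < N, s (i + 1) ^ 2 = s i ^ 2 - 1
  -- Makes `p τ` orthogonal to both `n N σ τ`.
  w_last : ∀ σ, w N σ = a - sgn σ * s N * b
  sq_add_sq : a ^ 2 + b ^ 2 = 1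
  b_nonneg : 0 ≤ b
  b_lt : b < s N * a

/-- The vertices of the chain in dimension three. -/
inductive ChainLabel (N : ℕ) : Type
  | v (i : Fin (N + 1)) (σ : Bool)
  | n (i : Fin (N + 1)) (σ τ : Bool)
  | k (i : Fin (N + 1)) (σ τ : Bool)
  | p (τ : Bool)
  | h

variable {N : ℕ}

namespace ChainLabel

instance : Finite (ChainLabel N) := by
  let F : Fin (N + 1) × Bool × Bool × Fin 5 → ChainLabel N := fun t =>
    if t.2.2.2 = 0 then v t.1 t.2.1 else if t.2.2.2 = 1 then n t.1 t.2.1 t.2.2.1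
    else if t.2.2.2 = 2 then k t.1 t.2.1 t.2.2.1 else if t.2.2.2 = 3 then p t.2.1 else h
  refine Finite.of_surjective F fun l => ?_
  cases l with
  | v i σ => exact ⟨(i, σ, true, 0), rfl⟩
  | n i σ τ => exact ⟨(i, σ, τ, 1), rfl⟩
  | k i σ τ => exact ⟨(i, σ, τ, 2), rfl⟩
  | p τ => exact ⟨(0, τ, true, 3), rfl⟩
  | h => exact ⟨(0, true, true, 4), rfl⟩

/-- The exponent of the phase of a vertex. -/
def level : ChainLabel N → ℕ
  | v i _ => i
  | n i _ _ => i
  | k i _ _ => i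
  | p _ => N
  | h => N

/-- The vertices of value `1` in a coloring of the chain. -/
def Positive : ChainLabel N → Prop
  | v _ σ => σ = true
  | n _ σ τ => σ = false ∧ τ = false
  | k _ σ τ => σ = false ∧ τ = true
  | p τ => τ = true
  | h => False

/-- A symmetric relation containing all orthogonalities of the chain. -/
def Rel : ChainLabel N → ChainLabel N → Prop
  | v i σ, n j σ' τ => (i = j ∧ σ = σ') ∨ (i.val = j.val + 1 ∧ σ = τ)
  | n j σ' τ, v i σ => (i = j ∧ σ = σ') ∨ (i.val = j.val + 1 ∧ σ = τ)
  | v i σ, k j σ' _ => i = j ∧ σ = σ'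
  | k j σ' _, v i σ => i = j ∧ σ = σ'
  | n i σ τ, n j σ' τ' => i = j ∧ σ ≠ σ' ∧ τ = τ'
  | n i σ τ, k j σ' τ' => i = j ∧ σ = σ' ∧ τ = τ'
  | k j σ' τ', n i σ τ => i = j ∧ σ = σ' ∧ τ = τ'
  | n j _ τ, p τ' => j.val = N ∧ τ = τ'
  | p τ', n j _ τ => j.val = N ∧ τ = τ'
  | p τ, p τ' => τ ≠ τ'
  -- If b = 0, then `h` is orthogonal to `v` at levels of opposite parity to N. Allowing all such
  -- pairs creates no triangle.
  | v _ _, h => True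
  | h, v _ _ => True
  | p _, h => True
  | h, p _ => True
  | _, _ => False

theorem Rel.symm {x y : ChainLabel N} (hxy : Rel x y) : Rel y x := by
  cases x <;> cases y <;> simp only [Rel] at hxy ⊢ <;> grind

theorem not_rel_of_positive {x y : ChainLabel N} (hx : x.Positive) (hy : y.Positive) :
    ¬ Rel x y := by
  cases x <;> cases y <;> simp only [Rel, Positive] at hx hy ⊢ <;> grind

theorem bool_pigeonhole {σ σ' σ'' : Bool} (h₁ : σ ≠ σ') (h₂ : σ' ≠ σ'') (h₃ : σ ≠ σ'') :
    False := by
  revert σ σ' σ''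
  decide

theorem positive_of_triangle {x y z : ChainLabel N} (hxy : Rel x y) (hyz : Rel y z)
    (hxz : Rel x z) : x.Positive ∨ y.Positive ∨ z.Positive := by
  cases x <;> cases y <;> simp only [Rel] at hxy <;>
    cases z <;> simp only [Rel] at hyz hxz <;> simp only [Positive] <;>
      first | grind | exact (bool_pigeonhole hxy.2.1 hyz.2.1 hxz.2.1).elim

end ChainLabel

/-! ### Every orthogonality of the chain lies in `Rel` -/

namespace ChainData

open ChainLabel

variable (D : ChainData N)

/-- The real coordinates of the vector of a vertex. -/
def coord : ChainLabel N → Fin 3 → ℝ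
  | v i σ => ![D.s i, sgn σ, 0]
  | n i σ τ => ![1, -(sgn σ * D.s i), -(sgn τ * D.w i σ)]
  | k i σ τ => ![D.w i σ, -(sgn σ * D.s i * D.w i σ), sgn τ * (D.s i ^ 2 + 1)]
  | p τ => ![D.a, D.b, sgn τ]
  | h => ![-D.b, D.a, 0]

theorem a_pos : 0 < D.a := by
  have h1 := D.one_lt N le_rfl
  have h2 := D.b_nonneg
  have h3 := D.b_lt
  by_contra h
  nlinarith

theorem rel_v_v {i : Fin (N + 1)} {σ σ' : Bool}
    (h : D.s i * D.s i + sgn σ * sgn σ' = 0) : False := by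
  have h1 := D.one_lt i (by omega)
  cases σ <;> cases σ' <;> simp only [sgn] at h <;> norm_num at h <;> nlinarith

theorem sign_eq_of_sub {σ τ : Bool} {x : ℝ} (hx : 0 < x) (h : x - sgn σ * sgn τ * x = 0) :
    σ = τ := by
  cases σ <;> cases τ <;> simp [sgn] at h ⊢ <;> linarith

theorem rel_n_n {i : Fin (N + 1)} {σ τ σ' τ' : Bool}
    (h : 1 + sgn σ * sgn σ' * D.s i ^ 2 + sgn τ * sgn τ' * (D.w i σ * D.w i σ') = 0) :
    σ ≠ σ' ∧ τ = τ' := by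
  have h1 := D.one_lt i (by omega)
  have h2 := D.w_pos i (by omega) σ
  have h3 := D.w_mul i (by omega) σ
  have h4 := D.w_sq_lt i (by omega) σ
  by_cases hσ : σ = σ'
  · subst hσ
    rw [sgn_mul_self] at h
    exfalso
    cases τ <;> cases τ' <;> simp only [sgn] at h <;> norm_num at h <;> nlinarith
  · obtain rfl : σ' = !σ := Bool.eq_not_of_ne (Ne.symm hσ)
    rw [h3] at h
    refine ⟨by simp, ?_⟩
    cases σ <;> cases τ <;> cases τ' <;> simp [sgn] at h ⊢ <;> nlinarith

theorem rel_n_k {i : Fin (N + 1)} {σ τ σ' τ' : Bool}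
    (h : D.w i σ' + sgn σ * sgn σ' * D.s i ^ 2 * D.w i σ' -
      sgn τ * sgn τ' * ((D.s i ^ 2 + 1) * D.w i σ) = 0) : σ = σ' ∧ τ = τ' := by
  have h1 := D.one_lt i (by omega)
  have h2 := D.w_pos i (by omega) σ
  have h3 := D.w_mul i (by omega) σ
  have h5 := D.w_pos i (by omega) (!σ)
  have h6 := D.w_sq_lt i (by omega) (!σ)
  by_cases hσ : σ = σ'
  · subst hσ
    refine ⟨rfl, sign_eq_of_sub (x := (D.s i ^ 2 + 1) * D.w i σ) (by positivity) ?_⟩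
    rw [sgn_mul_self] at h
    linarith
  · exfalso
    obtain rfl : σ' = !σ := Bool.eq_not_of_ne (Ne.symm hσ)
    have e1 : sgn σ * sgn (!σ) = -1 := by cases σ <;> norm_num [sgn]
    rw [e1] at h
    -- Multiplying the remaining equation by w_σ and using w_σ w_{!σ} = s² - 1 would give w_{!σ}² =
    -- s² + 1.
    have e2 : D.w i (!σ) ^ 2 * D.w i σ ^ 2 < (D.s i ^ 2 + 1) * D.w i σ ^ 2 :=
      mul_lt_mul_of_pos_right h6 (by positivity)
    have e3 : D.w i (!σ) ^ 2 * D.w i σ ^ 2 = (D.s i ^ 2 - 1) ^ 2 := by rw [← h3]; ring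
    have e5 : D.w i (!σ) * (D.s i ^ 2 - 1) * D.w i σ = (D.s i ^ 2 - 1) ^ 2 := by
      rw [← h3]
      ring
    have e6 : 0 < (D.s i ^ 2 + 1) * D.w i σ := by positivity
    have e7 : 0 < D.w i (!σ) * (D.s i ^ 2 - 1) := mul_pos h5 (by nlinarith)
    have e4 : sgn τ * sgn τ' = 1 ∨ sgn τ * sgn τ' = -1 := by
      cases τ <;> cases τ' <;> norm_num [sgn]
    rcases e4 with e4 | e4 <;> rw [e4] at h
    · nlinarith
    · have e8 : (D.s i ^ 2 + 1) * D.w i σ = D.w i (!σ) * (D.s i ^ 2 - 1) := by linarith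
      rw [← e8] at e5
      nlinarith

theorem rel_k_k {i : Fin (N + 1)} {σ τ σ' τ' : Bool}
    (h : D.w i σ * D.w i σ' + sgn σ * sgn σ' * D.s i ^ 2 * (D.w i σ * D.w i σ') +
      sgn τ * sgn τ' * (D.s i ^ 2 + 1) ^ 2 = 0) : False := by
  have h1 := D.one_lt i (by omega)
  have h2 := D.w_pos i (by omega) σ
  have h3 := D.w_mul i (by omega) σ
  have h4 := D.w_sq_lt i (by omega) σ
  have e4 : sgn τ * sgn τ' = 1 ∨ sgn τ * sgn τ' = -1 := by
    cases τ <;> cases τ' <;> norm_num [sgn]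
  by_cases hσ : σ = σ'
  · subst hσ
    rw [sgn_mul_self] at h
    have e5 : D.w i σ ^ 2 * (D.s i ^ 2 + 1) < (D.s i ^ 2 + 1) * (D.s i ^ 2 + 1) :=
      mul_lt_mul_of_pos_right h4 (by positivity)
    rcases e4 with e4 | e4 <;> rw [e4] at h
    · have : 0 < D.w i σ ^ 2 * (D.s i ^ 2 + 1) := by positivity
      nlinarith
    · nlinarith
  · obtain rfl : σ' = !σ := Bool.eq_not_of_ne (Ne.symm hσ)
    have e1 : sgn σ * sgn (!σ) = -1 := by cases σ <;> norm_num [sgn]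
    rw [e1, h3] at h
    rcases e4 with e4 | e4 <;> rw [e4] at h <;> nlinarith

theorem rel_k_p {σ τ τ' : Bool}
    (h : D.w N σ ^ 2 + sgn τ * sgn τ' * (D.s N ^ 2 + 1) = 0) : False := by
  have h2 := D.w_pos N le_rfl σ
  have h4 := D.w_sq_lt N le_rfl σ
  cases τ <;> cases τ' <;> simp only [sgn] at h <;> norm_num at h <;> nlinarith

theorem b_add_ne_zero (σ : Bool) : D.b + sgn σ * (D.s N * D.a) ≠ 0 := by
  have h1 := D.b_lt
  have h2 := D.b_nonneg
  cases σ <;> simp only [sgn] <;> intro h <;> norm_num at h <;> linarith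

theorem b_add_ne_zero' (σ : Bool) : D.s N * D.a + sgn σ * D.b ≠ 0 := by
  have h1 := D.b_lt
  have h2 := D.b_nonneg
  cases σ <;> simp only [sgn] <;> intro h <;> norm_num at h <;> linarith

/-- The dot product of the coordinates of two vertices. -/
def dot (x y : ChainLabel N) : ℝ :=
  D.coord x 0 * D.coord y 0 + D.coord x 1 * D.coord y 1 + D.coord x 2 * D.coord y 2

theorem dot_comm (x y : ChainLabel N) : D.dot x y = D.dot y x := by
  simp only [dot]
  ring

theorem rel_of_same_level_v {i : Fin (N + 1)} {σ : Bool} {y : ChainLabel N}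
    (hl : i.val = y.level) (h : D.dot (v i σ) y = 0) : Rel (v i σ) y := by
  have hs := D.one_lt i (by omega)
  cases y with
  | v j σ' =>
    obtain rfl : i = j := Fin.ext hl
    simp [dot, coord] at h
    exact (D.rel_v_v h).elim
  | n j σ' τ =>
    obtain rfl : i = j := Fin.ext hl
    simp [dot, coord] at h
    exact Or.inl ⟨rfl, sign_eq_of_sub (x := D.s i) (by linarith) (by linarith)⟩
  | k j σ' τ =>
    obtain rfl : i = j := Fin.ext hl
    simp [dot, coord] at h
    have hw := D.w_pos i (by omega) σ'
    exact ⟨rfl, sign_eq_of_sub (x := D.s i * D.w i σ') (by positivity) (by linarith)⟩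
  | p τ =>
    replace hl : i.val = N := hl
    simp [dot, coord, hl] at h
    exact (D.b_add_ne_zero' σ h).elim
  | h => trivial

theorem rel_of_same_level_n {i : Fin (N + 1)} {σ τ : Bool} {y : ChainLabel N}
    (hl : i.val = y.level) (h : D.dot (n i σ τ) y = 0) : Rel (n i σ τ) y := by
  have hs := D.one_lt i (by omega)
  have hw := D.w_pos i (by omega) σ
  cases y with
  | v j σ' =>
    rw [dot_comm] at h
    exact (D.rel_of_same_level_v hl.symm h).symm
  | n j σ' τ' =>
    obtain rfl : i = j := Fin.ext hl
    simp [dot, coord] at h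
    exact ⟨rfl, D.rel_n_n (by linarith)⟩
  | k j σ' τ' =>
    obtain rfl : i = j := Fin.ext hl
    simp [dot, coord] at h
    exact ⟨rfl, D.rel_n_k (by linarith)⟩
  | p τ' =>
    replace hl : i.val = N := hl
    simp [dot, coord, hl] at h
    rw [hl] at hw
    refine ⟨hl, sign_eq_of_sub hw ?_⟩
    have := D.w_last σ
    linarith
  | h =>
    replace hl : i.val = N := hl
    simp [dot, coord, hl] at h
    exact D.b_add_ne_zero σ (by linarith)

theorem rel_of_same_level_k {i : Fin (N + 1)} {σ τ : Bool} {y : ChainLabel N}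
    (hl : i.val = y.level) (h : D.dot (k i σ τ) y = 0) : Rel (k i σ τ) y := by
  have hw := D.w_pos i (by omega) σ
  cases y with
  | v j σ' =>
    rw [dot_comm] at h
    exact (D.rel_of_same_level_v hl.symm h).symm
  | n j σ' τ' =>
    rw [dot_comm] at h
    exact (D.rel_of_same_level_n hl.symm h).symm
  | k j σ' τ' =>
    obtain rfl : i = j := Fin.ext hl
    simp [dot, coord] at h
    exact D.rel_k_k (σ := σ) (σ' := σ') (τ := τ) (τ' := τ') (by linarith)
  | p τ' =>
    replace hl : i.val = N := hl
    simp [dot, coord, hl] at h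
    refine D.rel_k_p (σ := σ) (τ := τ) (τ' := τ') ?_
    have := D.w_last σ
    rw [sq]
    nth_rewrite 2 [this]
    linarith
  | h =>
    replace hl : i.val = N := hl
    simp [dot, coord, hl] at h
    rw [hl] at hw
    refine mul_ne_zero hw.ne' (D.b_add_ne_zero σ) ?_
    linarith

theorem rel_of_same_level {x y : ChainLabel N} (hl : x.level = y.level) (h : D.dot x y = 0) :
    Rel x y := by
  cases x with
  | v i σ => exact D.rel_of_same_level_v hl h
  | n i σ τ => exact D.rel_of_same_level_n hl h
  | k i σ τ => exact D.rel_of_same_level_k hl h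
  | p τ =>
    cases y with
    | v j σ' =>
      rw [dot_comm] at h
      exact (D.rel_of_same_level_v hl.symm h).symm
    | n j σ' τ' =>
      rw [dot_comm] at h
      exact (D.rel_of_same_level_n hl.symm h).symm
    | k j σ' τ' =>
      rw [dot_comm] at h
      exact (D.rel_of_same_level_k hl.symm h).symm
    | p τ' =>
      simp [dot, coord] at h
      rintro rfl
      have := D.sq_add_sq
      rw [sgn_mul_self] at h
      nlinarith
    | h => trivial
  | h =>
    cases y with
    | v j σ' => trivial
    | n j σ' τ' =>
      rw [dot_comm] at h
      exact (D.rel_of_same_level_n hl.symm h).symm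
    | k j σ' τ' =>
      rw [dot_comm] at h
      exact (D.rel_of_same_level_k hl.symm h).symm
    | p τ' => trivial
    | h =>
      simp [dot, coord] at h
      have := D.sq_add_sq
      exact absurd h (by nlinarith)

/-- Restricted to levels below N because the second coordinate of `p` is b, which may vanish. -/
theorem coord_one_ne_zero {x : ChainLabel N} (hx : x.level < N) : D.coord x 1 ≠ 0 := by
  have hsgn : ∀ σ, sgn σ ≠ 0 := fun σ => by cases σ <;> norm_num [sgn]
  cases x with
  | v i σ => simpa [coord] using hsgn σ
  | n i σ τ =>
    have := D.one_lt i (by omega)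
    simp [coord, hsgn]
    linarith
  | k i σ τ =>
    have := D.one_lt i (by omega)
    have := D.w_pos i (by omega) σ
    simp [coord, hsgn]
    constructor <;> linarith
  | p τ => exact absurd hx (lt_irrefl N)
  | h => exact absurd hx (lt_irrefl N)

theorem coord_zero_pos {x : ChainLabel N} (hx : x ≠ h) : 0 < D.coord x 0 := by
  cases x with
  | v i σ =>
    have := D.one_lt i (by omega)
    simp [coord]
    linarith
  | n i σ τ => simp [coord]
  | k i σ τ => simpa [coord] using D.w_pos i (by omega) σ
  | p τ => simpa [coord] using D.a_pos
  | h => exact absurd rfl hx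

/-- The z² coefficient kills the last coordinate of y, leaving only `v` and `h`; the constant
coefficient then decides. -/
theorem rel_of_succ_level {x y : ChainLabel N} (hl : y.level = x.level + 1)
    (h₁ : D.coord x 0 * D.coord y 0 + D.coord x 2 * D.coord y 1 = 0)
    (h₂ : D.coord x 1 * D.coord y 2 = 0) : Rel x y := by
  have hsgn : ∀ σ, sgn σ ≠ 0 := fun σ => by cases σ <;> norm_num [sgn]
  have hylev : y.level ≤ N := by cases y <;> simp [level] <;> omega
  have hx : x.level < N := by omega
  have hy2 : D.coord y 2 = 0 := (mul_eq_zero.1 h₂).resolve_left (D.coord_one_ne_zero hx)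
  cases y with
  | v j τ' =>
    cases x with
    | v i σ =>
      exfalso
      have := D.one_lt i (by omega)
      have := D.one_lt j (by omega)
      simp [coord] at h₁
      rcases h₁ with h₁ | h₁ <;> linarith
    | n i σ τ =>
      replace hl : j.val = i.val + 1 := hl
      have hs := D.one_lt j (by omega)
      have hw := D.w_of_lt i hx σ
      simp [coord, hw, ← hl] at h₁
      exact Or.inr ⟨hl, (sign_eq_of_sub (x := D.s j) (by linarith) (by linarith)).symm⟩
    | k i σ τ =>
      exfalso
      replace hl : j.val = i.val + 1 := hl
      have hs := D.one_lt j (by omega)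
      have hw := D.w_of_lt i hx σ
      have hss := D.s_succ i hx
      simp [coord, hw, ← hl] at h₁
      rw [← hl] at hss
      cases τ <;> cases τ' <;> simp only [sgn] at h₁ <;> norm_num at h₁ <;> nlinarith
    | p τ => exact absurd hx (lt_irrefl N)
    | h => exact absurd hx (lt_irrefl N)
  | n j σ τ =>
    have := D.w_pos j (by omega) σ
    simp [coord, hsgn] at hy2
    linarith
  | k j σ τ =>
    simp [coord, hsgn] at hy2
    nlinarith
  | p τ => exact absurd hy2 (hsgn τ)
  | h =>
    cases x with
    | v i σ => trivial
    | n i σ τ =>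
      replace hl : N = i.val + 1 := hl
      have hw := D.w_of_lt i hx σ
      simp only [← hl] at hw
      simp [coord, hw] at h₁
      exact D.b_add_ne_zero τ (by linarith)
    | k i σ τ =>
      exfalso
      replace hl : N = i.val + 1 := hl
      have hw := D.w_of_lt i hx σ
      have hss := D.s_succ i hx
      simp only [← hl] at hw hss
      simp [coord, hw] at h₁
      have hs := D.one_lt N le_rfl
      have ha := D.a_pos
      have hb := D.b_lt
      have hb0 := D.b_nonneg
      have e1 : D.s N * D.b < D.s N * (D.s N * D.a) := mul_lt_mul_of_pos_left hb (by linarith)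
      have e2 : 0 ≤ D.s N * D.b := by positivity
      have e3 : (D.s i ^ 2 + 1) * D.a = D.s N * (D.s N * D.a) + 2 * D.a := by
        have : D.s i ^ 2 = D.s N ^ 2 + 1 := by linarith
        rw [this]
        ring
      cases τ <;> simp only [sgn] at h₁ <;> norm_num at h₁ <;> linarith
    | p τ => exact absurd hx (lt_irrefl N)
    | h => exact absurd hx (lt_irrefl N)

/-- First coordinates are positive except at `h`, so y must be `h`, and then x must be some `v`. -/
theorem rel_of_lt_level {x y : ChainLabel N} (hl : x.level + 1 < y.level)
    (h₁ : D.coord x 0 * D.coord y 0 = 0)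
    (h₂ : D.coord x 1 * D.coord y 1 + D.coord x 2 * D.coord y 2 = 0 ∨
      D.coord x 2 * D.coord y 1 = 0) : Rel x y := by
  have hsgn : ∀ σ, sgn σ ≠ 0 := fun σ => by cases σ <;> norm_num [sgn]
  have hylev : y.level ≤ N := by cases y <;> simp [level] <;> omega
  have hx : x.level < N := by omega
  have hxh : x ≠ h := by
    rintro rfl
    exact lt_irrefl N hx
  have hyh : y = h := by
    by_contra hyh
    exact (mul_pos (D.coord_zero_pos hxh) (D.coord_zero_pos hyh)).ne' h₁
  subst hyh
  have hx1 := D.coord_one_ne_zero hx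
  have ha := D.a_pos
  have hx2 : D.coord x 2 = 0 := by
    have e1 : D.coord h 1 = D.a := rfl
    have e2 : D.coord h 2 = 0 := rfl
    rw [e1, e2, mul_zero, add_zero] at h₂
    simpa [ha.ne', hx1] using h₂
  cases x with
  | v i σ => trivial
  | n i σ τ =>
    have := D.w_pos i (by omega) σ
    simp [coord, hsgn] at hx2
    linarith
  | k i σ τ =>
    simp [coord, hsgn] at hx2
    nlinarith
  | p τ => exact absurd hx (lt_irrefl N)
  | h => exact absurd hx (lt_irrefl N)

end ChainData

end Chain

end Contextuality

namespace Contextuality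

open ChainLabel

/-! ### Frames of the chain and the forcing argument -/

namespace ChainData

variable {N : ℕ} (D : ChainData N) (e : ℕ) (z : ℂ)

/-- The vectors of the chain, together with the `e` remaining standard basis vectors. -/
noncomputable def vec : ChainLabel N ⊕ Fin e → EuclideanSpace ℂ (Fin (e + 3))
  | Sum.inl x => phasedVec e z x.level (D.coord x)
  | Sum.inr j => EuclideanSpace.single j.succ.succ.succ 1

theorem inner_vec_same_level (hz : ‖z‖ = 1) {x y : ChainLabel N} (hl : x.level = y.level) :
    inner ℂ (D.vec e z (Sum.inl x)) (D.vec e z (Sum.inl y)) = (D.dot x y : ℂ) := by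
  simp only [vec, hl]
  exact inner_phasedVec_self e hz _ _ _

theorem inner_vec_eq_zero {e : ℕ} {z : ℂ} (hz : ‖z‖ = 1) {x y : ChainLabel N}
    (hl : x.level = y.level) (h : D.dot x y = 0) :
    inner ℂ (D.vec e z (Sum.inl x)) (D.vec e z (Sum.inl y)) = 0 := by
  rw [D.inner_vec_same_level e z hz hl, h, Complex.ofReal_zero]

theorem inner_vec_inr_inl (j : Fin e) (x : ChainLabel N) :
    inner ℂ (D.vec e z (Sum.inr j)) (D.vec e z (Sum.inl x)) = 0 := by
  simp [vec, phasedVec, EuclideanSpace.inner_single_left]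

theorem inner_vec_inl_inr (j : Fin e) (x : ChainLabel N) :
    inner ℂ (D.vec e z (Sum.inl x)) (D.vec e z (Sum.inr j)) = 0 :=
  inner_eq_zero_symm.1 (D.inner_vec_inr_inl e z j x)

theorem inner_vec_inr_inr {i j : Fin e} (hij : i ≠ j) :
    inner ℂ (D.vec e z (Sum.inr i)) (D.vec e z (Sum.inr j)) = 0 := by
  simp [vec, EuclideanSpace.inner_single_left, hij]

/-- A phase for which orthogonality implies the relation `Rel`. -/
theorem exists_phase : ∃ z : ℂ, ‖z‖ = 1 ∧ ∀ x y : ChainLabel N,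
    inner ℂ (D.vec e z (Sum.inl x)) (D.vec e z (Sum.inl y)) = 0 → Rel x y := by
  obtain ⟨z, hz, h⟩ := exists_norm_eq_one_eval_ne_zero
    fun t : ChainLabel N × ChainLabel N =>
      phasedPoly t.1.level t.2.level (D.coord t.1) (D.coord t.2)
  have key : ∀ x y : ChainLabel N, x.level < y.level →
      inner ℂ (D.vec e z (Sum.inl x)) (D.vec e z (Sum.inl y)) = 0 → Rel x y := by
    intro x y hl hxy
    have hP : phasedPoly x.level y.level (D.coord x) (D.coord y) = 0 := by
      by_contra hne
      refine h (x, y) hne ?_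
      rw [← hxy]
      exact (inner_phasedVec e hz hl _ _).symm
    rcases Nat.lt_or_eq_of_le (Nat.succ_le_of_lt hl) with hl' | hl'
    · obtain ⟨h₁, h₂⟩ := phasedPoly_eq_zero hl' hP
      exact D.rel_of_lt_level hl' h₁ h₂
    · rw [← hl'] at hP
      obtain ⟨h₁, h₂⟩ := phasedPoly_succ_eq_zero hP
      exact D.rel_of_succ_level hl'.symm h₁ h₂
  refine ⟨z, hz, fun x y hxy => ?_⟩
  rcases lt_trichotomy x.level y.level with hl | hl | hl
  · exact key x y hl hxy
  · rw [D.inner_vec_same_level e z hz hl] at hxy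
    exact D.rel_of_same_level hl (by exact_mod_cast hxy)
  · exact (key y x hl (inner_eq_zero_symm.1 hxy)).symm

theorem vec_ne_zero (hz : ‖z‖ = 1) (i : ChainLabel N ⊕ Fin e) : D.vec e z i ≠ 0 := by
  rcases i with x | j
  · intro h
    have h1 := D.inner_vec_same_level e z hz (rfl : x.level = x.level)
    rw [h, inner_zero_left] at h1
    have h2 : Rel x x := D.rel_of_same_level rfl (by exact_mod_cast h1.symm)
    cases x <;> simp [ChainLabel.Rel] at h2
  · intro h
    have := congrArg norm h
    simp [vec] at this

variable {e z}

/-- Only e of the e + 3 members can be added basis vectors, so a frame contains a triangle of chain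
vertices. -/
theorem exists_positive_of_frame
    (hrel : ∀ x y : ChainLabel N,
      inner ℂ (D.vec e z (Sum.inl x)) (D.vec e z (Sum.inl y)) = 0 → Rel x y)
    {T : Finset (ChainLabel N ⊕ Fin e)} (hT : IsOrthogonalFrame (D.vec e z) T) :
    ∃ x : ChainLabel N, Sum.inl x ∈ T ∧ x.Positive := by
  have hcard := hT.1
  rw [← Finset.card_toLeft_add_card_toRight] at hcard
  have hle : T.toRight.card ≤ e := by simpa using Finset.card_le_univ T.toRight
  have h3 : 2 < T.toLeft.card := by omega
  obtain ⟨x, hx, y, hy, w, hw, hxy, hxw, hyw⟩ := Finset.two_lt_card.1 h3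
  rw [Finset.mem_toLeft] at hx hy hw
  have hne : ∀ {x y : ChainLabel N}, x ≠ y → (Sum.inl x : ChainLabel N ⊕ Fin e) ≠ Sum.inl y :=
    fun h h' => h (Sum.inl_injective h')
  rcases positive_of_triangle (hrel x y (hT.2 _ hx _ hy (hne hxy)))
    (hrel y w (hT.2 _ hy _ hw (hne hyw))) (hrel x w (hT.2 _ hx _ hw (hne hxw))) with h | h | h
  exacts [⟨x, hx, h⟩, ⟨y, hy, h⟩, ⟨w, hw, h⟩]

open Classical in
/-- A triple of vertices together with the remaining standard basis vectors. -/
noncomputable def frame (e : ℕ) (x y w : ChainLabel N) : Finset (ChainLabel N ⊕ Fin e) :=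
  ({x, y, w} : Finset (ChainLabel N)).disjSum Finset.univ

theorem isOrthogonalFrame_frame (hz : ‖z‖ = 1) {x y w : ChainLabel N}
    (hxy : inner ℂ (D.vec e z (Sum.inl x)) (D.vec e z (Sum.inl y)) = 0)
    (hxw : inner ℂ (D.vec e z (Sum.inl x)) (D.vec e z (Sum.inl w)) = 0)
    (hyw : inner ℂ (D.vec e z (Sum.inl y)) (D.vec e z (Sum.inl w)) = 0) :
    IsOrthogonalFrame (D.vec e z) (frame e x y w) := by
  classical
  have hne : ∀ {x y : ChainLabel N},
      inner ℂ (D.vec e z (Sum.inl x)) (D.vec e z (Sum.inl y)) = 0 → x ≠ y := by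
    rintro x _ h rfl
    exact D.vec_ne_zero e z hz _ (inner_self_eq_zero.1 h)
  refine ⟨?_, ?_⟩
  · rw [frame, Finset.card_disjSum, Finset.card_eq_three.2 ⟨x, y, w, hne hxy, hne hxw, hne hyw, rfl⟩]
    simp [add_comm]
  · rintro (i | i) hi (j | j) hj hij
    · simp only [frame, Finset.inl_mem_disjSum, Finset.mem_insert, Finset.mem_singleton] at hi hj
      have hyx := inner_eq_zero_symm.1 hxy
      have hwx := inner_eq_zero_symm.1 hxw
      have hwy := inner_eq_zero_symm.1 hyw
      rcases hi with rfl | rfl | rfl <;> rcases hj with rfl | rfl | rfl <;>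
        first | assumption | exact absurd rfl hij
    · exact D.inner_vec_inl_inr e z j i
    · exact D.inner_vec_inr_inl e z i j
    · exact D.inner_vec_inr_inr e z fun h => hij (h ▸ rfl)

theorem frame_v_n_k (hz : ‖z‖ = 1) (i : Fin (N + 1)) (σ τ : Bool) :
    IsOrthogonalFrame (D.vec e z) (frame e (v i σ) (n i σ τ) (k i σ τ)) := by
  have h1 := sgn_mul_self σ
  have h2 := sgn_mul_self τ
  refine D.isOrthogonalFrame_frame hz (D.inner_vec_eq_zero hz (by rfl) ?_)
    (D.inner_vec_eq_zero hz (by rfl) ?_) (D.inner_vec_eq_zero hz (by rfl) ?_) <;> simp [dot, coord]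
  · linear_combination -(D.s i) * h1
  · linear_combination -(D.s i) * (D.w i σ) * h1
  · linear_combination (D.s i) ^ 2 * (D.w i σ) * h1 - (D.s i ^ 2 + 1) * D.w i σ * h2

theorem dot_n_n (i : Fin (N + 1)) (τ : Bool) : D.dot (n i true τ) (n i false τ) = 0 := by
  have h2 := sgn_mul_self τ
  have h3 := D.w_mul i (by omega) true
  simp only [Bool.not_true] at h3
  simp [dot, coord, sgn_true, sgn_false]
  linear_combination h3 + D.w i true * D.w i false * h2

theorem frame_n_n_v (hz : ‖z‖ = 1) {i j : Fin (N + 1)} (hij : j.val = i.val + 1) (τ : Bool) :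
    IsOrthogonalFrame (D.vec e z) (frame e (n i true τ) (n i false τ) (v j τ)) := by
  have key : ∀ σ, inner ℂ (D.vec e z (Sum.inl (n i σ τ))) (D.vec e z (Sum.inl (v j τ))) = 0 := by
    intro σ
    have hl : (n i σ τ : ChainLabel N).level < (v j τ : ChainLabel N).level := by
      simp only [level]
      omega
    have e1 : (v j τ : ChainLabel N).level - (n i σ τ : ChainLabel N).level = 1 := by
      simp only [level]
      omega
    have h1 := sgn_mul_self τ
    have h2 := D.w_of_lt i (by omega) σ
    rw [vec, vec, inner_phasedVec e hz hl, phasedPoly, e1, if_neg (by simp)]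
    have h3 : D.coord (n i σ τ) 0 * D.coord (v j τ) 0 +
        D.coord (n i σ τ) 2 * D.coord (v j τ) 1 = 0 := by
      simp [coord, h2, ← hij]
      linear_combination -(D.s j) * h1
    -- This removes the z² term, so orthogonality holds for every phase.
    have h4 : D.coord (v j τ) 2 = 0 := rfl
    rw [h4]
    simp only [Polynomial.eval_add, Polynomial.eval_C, Polynomial.eval_mul, Polynomial.eval_pow]
    simp
    exact_mod_cast h3
  exact D.isOrthogonalFrame_frame hz (D.inner_vec_eq_zero hz (by rfl) (D.dot_n_n i τ))
    (key true) (key false)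

theorem frame_n_n_p (hz : ‖z‖ = 1) (τ : Bool) :
    IsOrthogonalFrame (D.vec e z)
      (frame e (n (Fin.last N) true τ) (n (Fin.last N) false τ) (p τ)) := by
  have h1 := sgn_mul_self τ
  refine D.isOrthogonalFrame_frame hz (D.inner_vec_eq_zero hz (by rfl) ?_)
    (D.inner_vec_eq_zero hz (by rfl) ?_) (D.inner_vec_eq_zero hz (by rfl) ?_)
  · exact D.dot_n_n _ τ
  · have h2 := D.w_last true
    simp [dot, coord]
    linear_combination -h2 - D.w N true * h1
  · have h2 := D.w_last false
    simp [dot, coord]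
    linear_combination -h2 - D.w N false * h1

theorem frame_p_p_h (hz : ‖z‖ = 1) :
    IsOrthogonalFrame (D.vec e z) (frame e (p true) (p false) h) := by
  have h1 := D.sq_add_sq
  refine D.isOrthogonalFrame_frame hz (D.inner_vec_eq_zero hz (by rfl) ?_)
    (D.inner_vec_eq_zero hz (by rfl) ?_) (D.inner_vec_eq_zero hz (by rfl) ?_) <;> simp [dot, coord, sgn]
  · linear_combination h1
  · ring
  · ring

theorem eq_zero_of_frame {ι : Type*} {T : Finset ι} {g : ι → ℝ} (hg : ∀ i, 0 ≤ g i)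
    (hsum : ∑ i ∈ T, g i = 1) {i j : ι} (hi : i ∈ T) (hj : j ∈ T) (hij : i ≠ j) (h : g i = 1) :
    g j = 0 := by
  classical
  have h1 : ∑ l ∈ ({i, j} : Finset ι), g l ≤ 1 := by
    rw [← hsum]
    refine Finset.sum_le_sum_of_subset_of_nonneg ?_ fun l _ _ => hg l
    intro l hl
    simp only [Finset.mem_insert, Finset.mem_singleton] at hl
    rcases hl with rfl | rfl <;> assumption
  rw [Finset.sum_pair hij, h] at h1
  linarith [hg j]

theorem add_lt_two_of_frames (hz : ‖z‖ = 1) (g : ChainLabel N ⊕ Fin e → ℝ)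
    (hg : ∀ i, g i ∈ Set.Icc (0 : ℝ) 1)
    (hsum : ∀ T, IsOrthogonalFrame (D.vec e z) T → ∑ i ∈ T, g i = 1) :
    g (Sum.inl (v 0 true)) + g (Sum.inl (v 0 false)) < 2 := by
  classical
  by_contra hlt
  have h0 : ∀ σ, g (Sum.inl (v 0 σ)) = 1 := by
    have h1 := (hg (Sum.inl (v 0 true))).2
    have h2 := (hg (Sum.inl (v 0 false))).2
    intro σ
    cases σ <;> linarith
  have hpos : ∀ i, 0 ≤ g i := fun i => (hg i).1
  -- The added basis vectors share a frame with `v 0 true`, so they drop out of all later sums.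
  have he : ∀ j : Fin e, g (Sum.inr j) = 0 := fun j =>
    eq_zero_of_frame hpos (hsum _ (D.frame_v_n_k hz 0 true true)) (i := Sum.inl (v 0 true))
      (by simp [frame]) (by simp [frame]) (by simp) (h0 true)
  have hn : ∀ i : Fin (N + 1), (∀ σ, g (Sum.inl (v i σ)) = 1) →
      ∀ σ τ, g (Sum.inl (n i σ τ)) = 0 := fun i hi σ τ =>
    eq_zero_of_frame hpos (hsum _ (D.frame_v_n_k hz i σ τ)) (i := Sum.inl (v i σ))
      (by simp [frame]) (by simp [frame]) (by simp) (hi σ)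
  have hthird : ∀ {x y w : ChainLabel N}, IsOrthogonalFrame (D.vec e z) (frame e x y w) →
      g (Sum.inl x) = 0 → g (Sum.inl y) = 0 → g (Sum.inl w) = 1 := by
    intro x y w hT hx hy
    rw [← hsum _ hT, frame, Finset.sum_disjSum, Finset.sum_eq_zero (s := Finset.univ)
      fun j _ => he j, add_zero]
    symm
    refine Finset.sum_eq_single_of_mem w (by simp) fun l hl hlw => ?_
    simp only [Finset.mem_insert, Finset.mem_singleton, hlw, or_false] at hl
    rcases hl with rfl | rfl <;> assumption
  -- Value 1 on both `v` propagates along the chain, through zeros on the `n` between levels.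
  have hv : ∀ m (hm : m < N + 1), ∀ σ, g (Sum.inl (v ⟨m, hm⟩ σ)) = 1 := by
    intro m
    induction m with
    | zero => exact fun _ => h0
    | succ m ih =>
      intro hm σ
      have hm' : m < N + 1 := by omega
      exact hthird (D.frame_n_n_v hz (i := ⟨m, hm'⟩) (j := ⟨m + 1, hm⟩) rfl σ)
        (hn _ (ih hm') true σ) (hn _ (ih hm') false σ)
  have hlast : ∀ σ τ, g (Sum.inl (n (Fin.last N) σ τ)) = 0 := hn _ (hv N (by omega))
  have hp : ∀ τ, g (Sum.inl (p τ)) = 1 := fun τ =>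
    hthird (D.frame_n_n_p hz τ) (hlast true τ) (hlast false τ)
  have hp0 : g (Sum.inl (p false)) = 0 :=
    eq_zero_of_frame hpos (hsum _ (D.frame_p_p_h hz)) (i := Sum.inl (p true))
      (by simp [frame]) (by simp [frame]) (by simp) (hp true)
  exact zero_ne_one (hp0.symm.trans (hp false))

theorem exists_isExtendedGadget (e : ℕ) {c : ℝ} (hc₀ : 0 < c) (hc₁ : c < 1)
    (hc : D.s 0 ^ 2 - 1 = c * (D.s 0 ^ 2 + 1)) :
    ∃ (n : ℕ) (G : SimpleGraph (Fin n)) (v₁ v₂ : Fin n), IsExtendedGadget G (e + 3) v₁ v₂ ∧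
      (∃ c₁ : Context G, v₁ ∈ c₁.1) ∧ (∃ c₂ : Context G, v₂ ∈ c₂.1) ∧
      ∃ φ : Fin n → EuclideanSpace ℂ (Fin (e + 3)), IsFaithfulRep G (e + 3) φ ∧
        inner ℂ (φ v₁) (φ v₂) = (c : ℂ) := by
  obtain ⟨z, hz, hrel⟩ := D.exists_phase e
  have hnorm : ∀ σ, ‖D.vec e z (Sum.inl (v 0 σ))‖ = √(D.s 0 ^ 2 + 1) := by
    intro σ
    have h1 := D.inner_vec_same_level e z hz (rfl : (v 0 σ : ChainLabel N).level = _)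
    rw [inner_self_eq_norm_sq_to_K] at h1
    have h2 : ‖D.vec e z (Sum.inl (v 0 σ))‖ ^ 2 = D.dot (v 0 σ) (v 0 σ) := by
      refine Complex.ofReal_injective (Eq.trans ?_ h1)
      push_cast
      rfl
    rw [← Real.sqrt_sq (norm_nonneg _), h2]
    congr 1
    simp [dot, coord]
    linear_combination sgn_mul_self σ
  refine exists_isExtendedGadget_of_vectors (D.vec e z) (D.vec_ne_zero e z hz)
    {i | ∃ x : ChainLabel N, i = Sum.inl x ∧ x.Positive} ?_ ?_
    (D.frame_v_n_k hz 0 true true) (D.frame_v_n_k hz 0 false true)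
    (i₁ := Sum.inl (v 0 true)) (i₂ := Sum.inl (v 0 false)) (by simp [frame]) (by simp [frame])
    hc₀ hc₁ ?_ fun g hg hsum => D.add_lt_two_of_frames hz g hg hsum
  · rintro _ ⟨x, rfl, hx⟩ _ ⟨y, rfl, hy⟩ hxy
    exact not_rel_of_positive hx hy (hrel x y hxy)
  · intro T hT
    obtain ⟨x, hxT, hx⟩ := D.exists_positive_of_frame hrel hT
    exact ⟨_, hxT, x, rfl, hx⟩
  · rw [hnorm, hnorm, Real.mul_self_sqrt (by positivity), ← hc,
      D.inner_vec_same_level e z hz (x := v 0 true) (y := v 0 false) rfl]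
    congr 1
    simp [dot, coord, sgn]
    ring

end ChainData

/-- Chain data whose first level has `cot² (θ / 2) = q`. -/
theorem exists_chainData {q : ℝ} (hq : 1 < q) : ∃ (N : ℕ) (D : ChainData N), D.s 0 ^ 2 = q := by
  -- The last value r = s_N² must exceed 1, and r ≤ 2 keeps b real.
  obtain ⟨N, hN₁, hN₂⟩ : ∃ N : ℕ, 1 < q - N ∧ q - N ≤ 2 := by
    have h2 : 1 < ⌈q⌉₊ := by
      have := Nat.le_ceil q
      by_contra h
      have h3 : (⌈q⌉₊ : ℝ) ≤ 1 := by exact_mod_cast not_lt.1 h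
      linarith
    refine ⟨⌈q⌉₊ - 2, ?_, ?_⟩
    · have h1 := Nat.ceil_lt_add_one (show 0 ≤ q by linarith)
      rw [Nat.cast_sub h2]
      push_cast
      linarith
    · have h1 := Nat.le_ceil q
      rw [Nat.cast_sub h2]
      push_cast
      linarith
  set r : ℝ := q - N with hr
  have hr1 : 0 < r + 1 := by linarith
  -- These solve a² + b² = 1 and a² - r b² = r - 1, the latter being `w_mul` at the last level.
  set a : ℝ := √((2 * r - 1) / (r + 1)) with ha
  set b : ℝ := √((2 - r) / (r + 1)) with hb
  have ha2 : a ^ 2 = (2 * r - 1) / (r + 1) :=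
    Real.sq_sqrt (div_nonneg (by linarith) hr1.le)
  have hb2 : b ^ 2 = (2 - r) / (r + 1) := Real.sq_sqrt (div_nonneg (by linarith) hr1.le)
  have ha0 : 0 < a := Real.sqrt_pos.2 (div_pos (by linarith) hr1)
  have hb0 : 0 ≤ b := Real.sqrt_nonneg _
  set t : ℝ := √r with ht
  have ht2 : t ^ 2 = r := Real.sq_sqrt (by linarith)
  have ht1 : 1 < t := by
    rw [ht, Real.lt_sqrt zero_le_one]
    linarith
  have hab : a ^ 2 + b ^ 2 = 1 := by
    rw [ha2, hb2]
    field_simp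
    ring
  have hab' : a ^ 2 - t ^ 2 * b ^ 2 = r - 1 := by
    rw [ha2, hb2, ht2]
    field_simp
    ring
  have hba : b < t * a := by
    have h1 : b ^ 2 < a ^ 2 := by
      rw [ha2, hb2]
      exact div_lt_div_of_pos_right (by linarith) hr1
    have h2 : b < a := lt_of_pow_lt_pow_left₀ 2 ha0.le h1
    nlinarith
  have htba : t * b < a := by
    refine lt_of_pow_lt_pow_left₀ 2 ha0.le ?_
    rw [mul_pow]
    linarith
  have hsgn : ∀ σ, sgn σ = 1 ∨ sgn σ = -1 := fun σ => by cases σ <;> simp [sgn]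
  have hlev : ∀ i ≤ N, 1 < q - i := fun i hi => by
    have : (i : ℝ) ≤ N := by exact_mod_cast hi
    linarith
  have hsq : ∀ i ≤ N, √(q - i) ^ 2 = q - i := fun i hi => Real.sq_sqrt (by linarith [hlev i hi])
  have hsucc : ∀ i < N, √(q - (i + 1 : ℕ)) ^ 2 = q - i - 1 := fun i hi => by
    rw [hsq (i + 1) hi]
    push_cast
    ring
  have hsqpos : ∀ i < N, 0 < √(q - (i + 1 : ℕ)) := fun i hi =>
    Real.sqrt_pos.2 (by linarith [hlev (i + 1) hi])
  refine ⟨N,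
    { s := fun i => √(q - i)
      w := fun i σ => if i < N then √(q - (i + 1 : ℕ)) else a - sgn σ * t * b
      a := a
      b := b
      one_lt := fun i hi => by
        rw [Real.lt_sqrt zero_le_one]
        linarith [hlev i hi]
      w_pos := fun i hi σ => ?_
      w_mul := fun i hi σ => ?_
      w_sq_lt := fun i hi σ => ?_
      w_of_lt := fun i hi σ => if_pos hi
      s_succ := fun i hi => by rw [hsucc i hi, hsq i hi.le]
      w_last := fun σ => if_neg (lt_irrefl N)
      sq_add_sq := hab
      b_nonneg := hb0
      b_lt := hba }, ?_⟩
  · split_ifs with h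
    · exact hsqpos i h
    · rcases hsgn σ with h | h <;> rw [h] <;> nlinarith
  · rw [hsq i hi]
    split_ifs with h
    · rw [← sq, hsucc i h]
    · obtain rfl : i = N := by omega
      have : sgn (!σ) = -sgn σ := by cases σ <;> simp [sgn]
      rw [this]
      linear_combination hab' - t ^ 2 * b ^ 2 * sgn_mul_self σ
  · rw [hsq i hi]
    split_ifs with h
    · rw [hsucc i h]
      linarith
    · obtain rfl : i = N := by omega
      rw [← hr, ← ht2]
      have h1 : (a - t * b) * (a - t * b) ≤ (a + t * b) * (a + t * b) := by
        have : 0 ≤ a * (t * b) := by positivity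
        nlinarith
      -- Lagrange's identity; b < ta makes the resulting Cauchy–Schwarz bound strict.
      have h2 : (a + t * b) ^ 2 + (t * a - b) ^ 2 = t ^ 2 + 1 := by
        linear_combination (t ^ 2 + 1) * hab
      have h3 : 0 < (t * a - b) ^ 2 := pow_pos (by linarith) 2
      rcases hsgn σ with h | h <;> rw [h] <;> nlinarith
  · simpa using hsq 0 (Nat.zero_le N)

theorem exists_isExtendedGadget {d : ℕ} (hd : 3 ≤ d) {θ : ℝ}
    (hθ : θ ∈ Set.Ioo 0 (Real.pi / 2)) :
    ∃ (n : ℕ) (G : SimpleGraph (Fin n)) (v₁ v₂ : Fin n), IsExtendedGadget G d v₁ v₂ ∧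
      (∃ c₁ : Context G, v₁ ∈ c₁.1) ∧ (∃ c₂ : Context G, v₂ ∈ c₂.1) ∧
      ∃ φ : Fin n → EuclideanSpace ℂ (Fin d), IsFaithfulRep G d φ ∧
        inner ℂ (φ v₁) (φ v₂) = (Real.cos θ : ℂ) := by
  obtain ⟨e, rfl⟩ := Nat.exists_eq_add_of_le' hd
  have hc₀ : 0 < Real.cos θ := Real.cos_pos_of_mem_Ioo ⟨by linarith [hθ.1, hθ.2], hθ.2⟩
  have hc₁ : Real.cos θ < 1 := by
    rw [← Real.cos_zero]
    exact Real.cos_lt_cos_of_nonneg_of_le_pi_div_two le_rfl hθ.2.le hθ.1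
  -- This quotient is cot²(θ/2), the solution of q - 1 = cos θ · (q + 1).
  have hq : 1 < (1 + Real.cos θ) / (1 - Real.cos θ) := by
    rw [lt_div_iff₀ (by linarith)]
    linarith
  obtain ⟨N, D, hD⟩ := exists_chainData hq
  refine D.exists_isExtendedGadget e hc₀ hc₁ ?_
  have : 1 - Real.cos θ ≠ 0 := by linarith
  rw [hD]
  field_simp
  ring

theorem exists_angle_cos_gt {ε : ℝ} (hε : 0 < ε) :
    ∃ θ ∈ Set.Ioo 0 (Real.pi / 2), 1 - ε < Real.cos θ := by
  have h1 : ∀ᶠ θ in nhdsWithin (0 : ℝ) (Set.Ioi 0), 1 - ε < Real.cos θ := by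
    refine (Real.continuous_cos.continuousWithinAt (s := Set.Ioi (0 : ℝ)) (x := 0)).eventually_const_lt ?_
    rw [Real.cos_zero]
    linarith
  have h2 : ∀ᶠ θ in nhdsWithin (0 : ℝ) (Set.Ioi 0), θ ∈ Set.Ioo 0 (Real.pi / 2) :=
    Ioo_mem_nhdsGT (by positivity)
  obtain ⟨θ, h, h'⟩ := (h2.and h1).exists
  exact ⟨θ, h, h'⟩

end Contextuality

theorem mainTheorem3 :
    -- every extended gadget gives an inequality for the (fundamentally) binary boxes,
    -- whose algebraic bound is 2 and which quantum states violate up to `1 + cos θ`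
    (∀ (V : Type*) [Fintype V] (G : SimpleGraph V) (d : ℕ) (v₁ v₂ : V),
      Contextuality.IsExtendedGadget G d v₁ v₂ →
      (Contextuality.binConsBoxes G).Nonempty ∧
      ∀ (c₁ c₂ : Contextuality.Context G) (h₁ : v₁ ∈ c₁.1) (h₂ : v₂ ∈ c₂.1),
        (∀ P ∈ Contextuality.binConsBoxes G, Contextuality.pairValue h₁ h₂ P ≤ 3 / 2) ∧
        (∀ P ∈ Contextuality.fundBinaryBoxes G, Contextuality.pairValue h₁ h₂ P ≤ 3 / 2) ∧
        IsGreatest (Contextuality.pairValue h₁ h₂ '' {P | Contextuality.IsBox G P}) 2 ∧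
        ∀ (θ : ℝ), θ ∈ Set.Ioo 0 (Real.pi / 2) →
          ∀ φ : V → EuclideanSpace ℂ (Fin d), Contextuality.IsFaithfulRep G d φ →
          inner ℂ (φ v₁) (φ v₂) = (Real.cos θ : ℂ) →
          ∀ ψ : EuclideanSpace ℂ (Fin d),
            ψ = ((1 / Real.sqrt (2 * (1 + Real.cos θ)) : ℝ) : ℂ) • (φ v₁ + φ v₂) →
            ‖ψ‖ = 1 ∧
            Contextuality.IsConsistentBox G (Contextuality.bornBox G φ ψ) ∧
            Contextuality.pairValue h₁ h₂ (Contextuality.bornBox G φ ψ) = 1 + Real.cos θ) ∧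
    -- extended gadgets exist in every dimension `d ≥ 3` and for every angle
    (∀ d : ℕ, 3 ≤ d → ∀ θ : ℝ, θ ∈ Set.Ioo 0 (Real.pi / 2) →
      ∃ (n : ℕ) (G : SimpleGraph (Fin n)) (v₁ v₂ : Fin n),
        Contextuality.IsExtendedGadget G d v₁ v₂ ∧
        (∃ c₁ : Contextuality.Context G, v₁ ∈ c₁.1) ∧
        (∃ c₂ : Contextuality.Context G, v₂ ∈ c₂.1) ∧
        ∃ φ : Fin n → EuclideanSpace ℂ (Fin d), Contextuality.IsFaithfulRep G d φ ∧
          inner ℂ (φ v₁) (φ v₂) = (Real.cos θ : ℂ)) ∧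
    -- hence violations arbitrarily close to the algebraic bound
    (∀ d : ℕ, 3 ≤ d → ∀ ε : ℝ, 0 < ε →
      ∃ (n : ℕ) (G : SimpleGraph (Fin n)) (v₁ v₂ : Fin n) (c₁ c₂ : Contextuality.Context G)
        (h₁ : v₁ ∈ c₁.1) (h₂ : v₂ ∈ c₂.1),
        Contextuality.IsExtendedGadget G d v₁ v₂ ∧
        (Contextuality.binConsBoxes G).Nonempty ∧
        (∀ P ∈ Contextuality.fundBinaryBoxes G, Contextuality.pairValue h₁ h₂ P ≤ 3 / 2) ∧
        IsGreatest (Contextuality.pairValue h₁ h₂ '' {P | Contextuality.IsBox G P}) 2 ∧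
        ∃ P ∈ Contextuality.quantumBoxes G d, 2 - ε < Contextuality.pairValue h₁ h₂ P) := by
  refine ⟨?_, fun d hd θ hθ => Contextuality.exists_isExtendedGadget hd hθ, ?_⟩
  · intro V _ G d v₁ v₂ hG
    refine ⟨hG.binConsBoxes_nonempty, fun c₁ c₂ h₁ h₂ => ⟨?_, ?_, ?_, ?_⟩⟩
    · exact fun P hP => hG.pairValue_le_of_mem_binConsBoxes h₁ h₂ hP
    · exact fun P hP => hG.pairValue_le_of_mem_binConsBoxes h₁ h₂ (hG.fundBinaryBoxes_subset hP)
    · exact hG.isGreatest_pairValue h₁ h₂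
    · exact fun θ hθ φ hφ hin ψ hψ => hG.quantum_value h₁ h₂ hθ hφ hin hψ
  · intro d hd ε hε
    obtain ⟨θ, hθ, hcos⟩ := Contextuality.exists_angle_cos_gt hε
    obtain ⟨n, G, v₁, v₂, hG, ⟨c₁, h₁⟩, ⟨c₂, h₂⟩, φ, hφ, hin⟩ :=
      Contextuality.exists_isExtendedGadget hd hθ
    obtain ⟨hψ, -, hval⟩ := hG.quantum_value h₁ h₂ hθ hφ hin rfl
    refine ⟨n, G, v₁, v₂, c₁, c₂, h₁, h₂, hG, hG.binConsBoxes_nonempty,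
      fun P hP => hG.pairValue_le_of_mem_binConsBoxes h₁ h₂ (hG.fundBinaryBoxes_subset hP),
      hG.isGreatest_pairValue h₁ h₂, _, ⟨φ, hφ, _, hψ, rfl⟩, ?_⟩
    rw [hval]
    linarith
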